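/- Let $p_1,p_2\ge 0$ be coprime integers, and give $x,y$ the weights $p_1,p_2$; put $R=p_1x\,\partial_x+p_2y\,\partial_y$. Let $h\in\mathbb C[x,y]$ be quasi-homogeneous of weighted degree $\delta$ (that is, every monomial $x^ky^l$ of $h$ satisfies $p_1k+p_2l=\delta$), and suppose that $h$ has an isolated singularity at the origin: $h_x(0)=h_y(0)=0$ and $\mathbb C[[x,y]]/J_0$ is finite-dimensional, where $J_0=(h_x,h_y)$. Let $a_1,\dots,a_\mu$ be quasi-homogeneous polynomials (for instance monomials) whose classes form a basis of the vector space $\mathbb C[[x,y]]/J_0$. Put $$\omega_0=\frac1\delta\frac{dh}{h},\qquad \omega_R=i_R\Big(\frac{dx\wedge dy}{h}\Big)=\frac{p_1x\,dy-p_2y\,dx}{h}.$$ Let $\omega$ be a formal logarithmic $1$-form with poles on $\{h=0\}$ (that is, $h\omega$ and $h\,d\omega$ have coefficients in $\mathbb C[[x,y]]$) which is a perturbation $\omega=\omega_0+\cdots$ of the closed form $\omega_0$ by terms of higher quasi-homogeneous degree: with $dx,dy$ given the weights $p_1,p_2$, all the terms of $h(\omega-\omega_0)$ have weighted degree $>\delta$.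 Then there exist $(d_1,\dots,d_\mu)\in\mathbb C[[t]]^{\mu}$, a formal diffeomorphism $\Phi$ of $(\mathbb C^2,0)$ and a formal unit $u\in\mathbb C[[x,y]]$, $u(0)\ne0$, such that $\Phi$ is fibred with respect to $R$, i.e. $\Phi=\exp(bR)$ for some $b\in\mathbb C[[x,y]]$ with $b(0)=0$ (meaning $f\circ\Phi=\sum_{n\ge0}(bR)^n(f)/n!$ for all $f\in\mathbb C[[x,y]]$), and $$\Phi^*\omega=u\Big(\omega_0+\sum_{i=1}^{\mu}d_i(h)\,a_i\,\omega_R\Big).$$ -/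

import Mathlib

noncomputable section

namespace LogFoliation

/-- The ring `ℂ[[x, y]]` of formal power series at the origin of `ℂ²`
(`x` has index `0`, `y` has index `1`). -/
abbrev Formal : Type := MvPowerSeries (Fin 2) ℂ

/-- The field of formal meromorphic functions at the origin of `ℂ²`. -/
abbrev Mero : Type := FractionRing Formal

/-- A formal meromorphic 1-form `ω 0 dx + ω 1 dy`. -/
abbrev MeroForm : Type := Fin 2 → Mero

/-- The partial derivative of a formal meromorphic function, by the quotient rule applied to a
chosen representation as a fraction; `meroPderiv_div` shows that the choice does not matter. -/
def meroPderiv (i : Fin 2) (z : Mero) : Mero :=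
  let a : Formal := (IsLocalization.sec (nonZeroDivisors Formal) z).1
  let s : Formal := (IsLocalization.sec (nonZeroDivisors Formal) z).2
  algebraMap Formal Mero (MvPowerSeries.pderiv ℂ i a * s - a * MvPowerSeries.pderiv ℂ i s) /
    algebraMap Formal Mero s ^ 2

theorem meroPderiv_div (i : Fin 2) (f g : Formal) (hg : g ≠ 0) :
    meroPderiv i (algebraMap Formal Mero f / algebraMap Formal Mero g) =
      algebraMap Formal Mero (MvPowerSeries.pderiv ℂ i f * g - f * MvPowerSeries.pderiv ℂ i g) /
        algebraMap Formal Mero g ^ 2 := by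
  have inj := IsFractionRing.injective Formal Mero
  have hg' : algebraMap Formal Mero g ≠ 0 := fun h => hg (inj (by rw [h, map_zero]))
  unfold meroPderiv
  generalize hz : algebraMap Formal Mero f / algebraMap Formal Mero g = z
  have hs := IsLocalization.sec_spec (M := nonZeroDivisors Formal) (S := Mero) z
  have hs0 : ((IsLocalization.sec (nonZeroDivisors Formal) z).2 : Formal) ≠ 0 :=
    nonZeroDivisors.coe_ne_zero _
  generalize (IsLocalization.sec (nonZeroDivisors Formal) z).1 = a at *
  generalize ((IsLocalization.sec (nonZeroDivisors Formal) z).2 : Formal) = s at *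
  have hs' : algebraMap Formal Mero s ≠ 0 := fun h => hs0 (inj (by rw [h, map_zero]))
  have e : f * s = a * g := by
    apply inj
    rw [map_mul, map_mul, ← hs, ← hz]
    field_simp
  have e' := congrArg (MvPowerSeries.pderiv ℂ i) e
  simp only [Derivation.leibniz, smul_eq_mul] at e'
  rw [div_eq_div_iff (pow_ne_zero 2 hs') (pow_ne_zero 2 hg'), ← map_pow, ← map_pow, ← map_mul,
    ← map_mul]
  congr 1
  linear_combination (-(s * g)) * e' + (g * MvPowerSeries.pderiv ℂ i s + s * MvPowerSeries.pderiv ℂ i g) * e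

/-- A meromorphic function that is in fact a formal power series. -/
def IsHol (z : Mero) : Prop := ∃ f : Formal, z = algebraMap Formal Mero f

/-- `ω` is a formal logarithmic 1-form with poles on `{h = 0}`: both `h ω` and `h dω` are
holomorphic. -/
def IsLogForm (h : Formal) (ω : MeroForm) : Prop :=
  (∀ i, IsHol (algebraMap Formal Mero h * ω i)) ∧
    IsHol (algebraMap Formal Mero h * (meroPderiv 0 (ω 1) - meroPderiv 1 (ω 0)))

/-- A formal vector field `X 0 ∂/∂x + X 1 ∂/∂y`. -/
abbrev FormalField : Type := Fin 2 → Formal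

/-- The derivation `f ↦ X(f)` defined by a formal vector field. -/
def FormalField.act (X : FormalField) (f : Formal) : Formal :=
  ∑ i, X i * MvPowerSeries.pderiv ℂ i f

/-- The dual logarithmic form `i_X Ω` of a vector field, where `Ω = (dx ∧ dy) / h`. -/
def sharp (h : Formal) (X : FormalField) : MeroForm :=
  ![-(algebraMap Formal Mero (X 1) / algebraMap Formal Mero h),
    algebraMap Formal Mero (X 0) / algebraMap Formal Mero h]

/-- The weighted radial field `R = p₁ x ∂/∂x + p₂ y ∂/∂y`. -/
def radial (p : Fin 2 → ℕ) : FormalField := fun i => (p i : Formal) * MvPowerSeries.X i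

/-- `ω_R = i_R Ω = (p₁ x dy - p₂ y dx) / h`. -/
def omegaR (p : Fin 2 → ℕ) (h : Formal) : MeroForm := sharp h (radial p)

/-- `ω₀ = δ⁻¹ dh / h`. -/
def omega0 (h : Formal) (δ : ℕ) : MeroForm := fun i =>
  (δ : Mero)⁻¹ * (algebraMap Formal Mero (MvPowerSeries.pderiv ℂ i h) / algebraMap Formal Mero h)

/-- `ω = ω₀ + ⋯` is a logarithmic perturbation of `ω₀` by terms of higher quasi-homogeneous degree:
`ω - ω₀` has only terms of positive degree, where `dx`, `dy` have the degrees of `x`, `y`.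
Since `h` is quasi-homogeneous of degree `δ`, this means that `h (ω - ω₀)` has only terms of
degree greater than `δ`. -/
def IsPerturbation (p : Fin 2 → ℕ) (h : Formal) (δ : ℕ) (ω : MeroForm) : Prop :=
  IsLogForm h ω ∧
    ∃ η : Fin 2 → Formal,
      (∀ i, algebraMap Formal Mero h * (ω i - omega0 h δ i) = algebraMap Formal Mero (η i)) ∧
      ∀ i m, MvPowerSeries.coeff m (η i) ≠ 0 → δ < Finsupp.weight p m + p i

/-- A formal diffeomorphism `Φ` of `(ℂ², 0)`, given by the automorphism `f ↦ f ∘ Φ` of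
`ℂ[[x, y]]`. -/
abbrev FormalDiffeo : Type := Formal ≃ₐ[ℂ] Formal

/-- Pullback `Φ^* ω` of a meromorphic 1-form; the component `i` of `Φ` is `Φ (X i)`. -/
def FormalDiffeo.pullback (Φ : FormalDiffeo) (ω : MeroForm) : MeroForm := fun j =>
  ∑ i, IsFractionRing.ringEquivOfRingEquiv (K := Mero) (L := Mero) Φ.toRingEquiv (ω i) *
    algebraMap Formal Mero (MvPowerSeries.pderiv ℂ j (Φ (MvPowerSeries.X i)))

/-- `Φ = exp X`: `f ∘ Φ = ∑ₙ Xⁿ(f) / n!` for every `f`, the series converging coefficientwise. -/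
def FormalDiffeo.IsExp (Φ : FormalDiffeo) (X : FormalField) : Prop :=
  ∀ (f : Formal) (m : Fin 2 →₀ ℕ),
    HasSum (fun n : ℕ => ((n.factorial : ℂ))⁻¹ * MvPowerSeries.coeff m (X.act^[n] f))
      (MvPowerSeries.coeff m (Φ f))

/-- `Φ` is fibred with respect to `R`: it is the exponential of a multiple `b R` of `R`, with
`b` vanishing at the origin, so that `Φ` is tangent to the identity. -/
def FormalDiffeo.IsFibred (p : Fin 2 → ℕ) (Φ : FormalDiffeo) : Prop :=
  ∃ b : Formal, MvPowerSeries.constantCoeff b = 0 ∧ Φ.IsExp (fun i => b * radial p i)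

/-- The Jacobian ideal of `h`, generated by the components of the Hamiltonian field of `h`. -/
def jacobianIdeal (h : Formal) : Ideal Formal :=
  Ideal.span (Set.range fun i => MvPowerSeries.pderiv ℂ i h)

/-- `h` has an isolated singularity at the origin: the origin is a critical point, and the Milnor
algebra is finite-dimensional. -/
def HasIsolatedSingularity (h : Formal) : Prop :=
  (∀ i, MvPowerSeries.constantCoeff (MvPowerSeries.pderiv ℂ i h) = 0) ∧
    Module.Finite ℂ (Formal ⧸ jacobianIdeal h)

/-- The form `ω₀ + ∑ᵢ dᵢ(h) aᵢ ω_R`. -/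
def normalForm (p : Fin 2 → ℕ) (h : Formal) (δ : ℕ) {μ : ℕ} (a : Fin μ → Formal)
    (d : Fin μ → PowerSeries ℂ) : MeroForm := fun j =>
  omega0 h δ j + ∑ i, algebraMap Formal Mero (PowerSeries.subst h (d i) * a i) * omegaR p h j

end LogFoliation

end

/-! Write p₀, p₁ for the weights, H = h_x ∂_y - h_y ∂_x (`hamDer h`) and filter power series by
weighted order.

Saito coordinates: contracting a logarithmic form with R and wedging it with dh give, after division
by h, its coefficients on ω₀ and ω_R (`exists_saito_coordinates`). Hence ω is a unit times ω₀ + c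
ω_R, with c of suitably high order (`exists_eq_unit_mul`).

Effect of a fibred diffeomorphism: Φ = exp(bR) sends a quasi-homogeneous f of weight k to f U^k for
one unit U = exp(b(R+1))(1) (`expTw_of_mem_hom`). Since dU = R(U) ω₀ + δ⁻¹ H(U) ω_R, the form U
Φ^*(ω₀ + c ω_R) equals (U + R(U)) ω₀ + (δ⁻¹ H(U) + Φ(c) U^(p₀+p₁+1-δ)) ω_R. It is proportional to ω₀
+ ∑ dᵢ(h) aᵢ ω_R as soon as `residue` vanishes (`numerator_pullback`).

Solving `residue = 0`: to leading order, a change β of b and a change ε of d alter the residue by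
δ⁻¹ H(β) - ∑ εᵢ(h) aᵢ (`residue_sub_sub_mem`). This linear map is onto in each weight
(`exists_homogeneous_decomposition`): modulo the span of the aᵢ a series lies in the Jacobian ideal,
and by Euler's identity A₀ h_x + A₁ h_y = H(g) + h q with q of lower weight
(`jacobian_combination_eq`). Correcting one weight at a time converges (`exists_residue_eq_zero`).
-/

noncomputable section

namespace LogFoliation

open MvPowerSeries

/-! ### Weighted orders and quasi-homogeneous components. -/

section

/-- The weight of a monomial, as an integer. -/
def wt (p : Fin 2 → ℕ) (n : Fin 2 →₀ ℕ) : ℤ := (Finsupp.weight p n : ℕ)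

theorem wt_eq (p : Fin 2 → ℕ) (n : Fin 2 →₀ ℕ) : wt p n = n 0 * p 0 + n 1 * p 1 := by
  simp [wt, Finsupp.weight_apply, Finsupp.sum_fintype, Fin.sum_univ_two]

theorem wt_add (p : Fin 2 → ℕ) (m n : Fin 2 →₀ ℕ) : wt p (m + n) = wt p m + wt p n := by
  simp [wt]

theorem wt_single (p : Fin 2 → ℕ) (i : Fin 2) (k : ℕ) :
    wt p (Finsupp.single i k) = k * p i := by
  simp [wt, Finsupp.weight_single]

theorem wt_nonneg (p : Fin 2 → ℕ) (n : Fin 2 →₀ ℕ) : 0 ≤ wt p n := Int.natCast_nonneg _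

/-- Power series all of whose monomials have a weight in `S`. -/
def ws (p : Fin 2 → ℕ) (S : Set ℤ) : Submodule ℂ Formal where
  carrier := {f | ∀ n, coeff n f ≠ 0 → wt p n ∈ S}
  add_mem' {f g} hf hg n hn := by
    by_cases h : coeff n f = 0
    · exact hg n fun h' => hn (by simp [h, h'])
    · exact hf n h
  zero_mem' n hn := by simp at hn
  smul_mem' c f hf n hn := hf n fun h => hn (by simp [h])

/-- Power series of weighted order at least `d`. -/
abbrev fil (p : Fin 2 → ℕ) (d : ℤ) : Submodule ℂ Formal := ws p (Set.Ici d)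

/-- Quasi-homogeneous power series of weight `d`. -/
abbrev hom (p : Fin 2 → ℕ) (d : ℤ) : Submodule ℂ Formal := ws p {d}

variable {p : Fin 2 → ℕ} {S T U : Set ℤ} {f g : Formal} {d e : ℤ}

theorem coeff_eq_zero_of_mem_ws (hf : f ∈ ws p S) {n : Fin 2 →₀ ℕ} (hn : wt p n ∉ S) :
    coeff n f = 0 := by
  by_contra h
  exact hn (hf n h)

theorem ws_mono (h : S ⊆ T) : ws p S ≤ ws p T := fun _ hf n hn => h (hf n hn)

theorem fil_mono (h : d ≤ e) : fil p e ≤ fil p d := ws_mono (Set.Ici_subset_Ici.2 h)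

theorem hom_le_fil (d : ℤ) : hom p d ≤ fil p d := ws_mono (by simp)

theorem mul_mem_ws (hf : f ∈ ws p S) (hg : g ∈ ws p T) (h : ∀ s ∈ S, ∀ t ∈ T, s + t ∈ U) :
    f * g ∈ ws p U := by
  classical
  intro n hn
  rw [coeff_mul] at hn
  obtain ⟨x, hx, hx0⟩ := Finset.exists_ne_zero_of_sum_ne_zero hn
  rw [← Finset.HasAntidiagonal.mem_antidiagonal.1 hx, wt_add]
  exact h _ (hf _ (left_ne_zero_of_mul hx0)) _ (hg _ (right_ne_zero_of_mul hx0))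

theorem mul_mem_fil (hf : f ∈ fil p d) (hg : g ∈ fil p e) : f * g ∈ fil p (d + e) :=
  mul_mem_ws hf hg fun s hs t ht => by simp only [Set.mem_Ici] at *; omega

theorem mul_mem_hom (hf : f ∈ hom p d) (hg : g ∈ hom p e) : f * g ∈ hom p (d + e) :=
  mul_mem_ws hf hg fun s hs t ht => by simp only [Set.mem_singleton_iff] at *; omega

theorem pderiv_mem_ws {i : Fin 2} (hf : f ∈ ws p S) (h : ∀ s ∈ S, s - p i ∈ T) :
    pderiv ℂ i f ∈ ws p T := by
  intro n hn
  rw [coeff_pderiv] at hn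
  have := h _ (hf _ (left_ne_zero_of_mul hn))
  rw [wt_add, wt_single] at this
  simpa using this

theorem pderiv_mem_fil (i : Fin 2) (hf : f ∈ fil p d) : pderiv ℂ i f ∈ fil p (d - p i) :=
  pderiv_mem_ws hf fun s hs => by simp only [Set.mem_Ici] at *; omega

theorem pderiv_mem_hom (i : Fin 2) (hf : f ∈ hom p d) : pderiv ℂ i f ∈ hom p (d - p i) :=
  pderiv_mem_ws hf fun s hs => by simp only [Set.mem_singleton_iff] at *; omega

theorem X_mem_hom (i : Fin 2) : (X i : Formal) ∈ hom p (p i) := by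
  classical
  intro n hn
  rw [coeff_X] at hn
  have : n = Finsupp.single i 1 := by by_contra h; simp [h] at hn
  simp [this, wt_single]

theorem one_mem_hom : (1 : Formal) ∈ hom p 0 := by
  classical
  intro n hn
  rw [coeff_one] at hn
  have : n = 0 := by by_contra h; simp [h] at hn
  simp [this, wt]

theorem mem_fil_zero (f : Formal) : f ∈ fil p 0 := fun n _ => wt_nonneg p n

theorem mem_fil_of_nonpos (hd : d ≤ 0) (f : Formal) : f ∈ fil p d :=
  fil_mono hd (mem_fil_zero f)

theorem eq_zero_of_mem_hom_neg (hd : d < 0) (hf : f ∈ hom p d) : f = 0 := by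
  ext n
  refine coeff_eq_zero_of_mem_ws hf ?_
  have := wt_nonneg p n
  simp only [Set.mem_singleton_iff]
  omega

theorem eq_zero_of_forall_mem_fil (c : ℤ) (hf : ∀ N : ℕ, f ∈ fil p (c + N)) : f = 0 := by
  ext n
  refine coeff_eq_zero_of_mem_ws (hf (wt p n - c + 1).toNat) ?_
  simp only [Set.mem_Ici]
  omega

theorem pow_mem_hom (hf : f ∈ hom p d) (k : ℕ) : f ^ k ∈ hom p (k * d) := by
  induction k with
  | zero => simpa using one_mem_hom
  | succ k ih =>
    rw [pow_succ]
    convert mul_mem_hom ih hf using 2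
    push_cast
    ring

theorem constantCoeff_eq_zero_of_mem_fil_one (hf : f ∈ fil p 1) : constantCoeff f = 0 := by
  rw [← coeff_zero_eq_constantCoeff_apply]
  exact coeff_eq_zero_of_mem_ws hf (by simp [wt])

theorem coe_mem_hom {P : MvPolynomial (Fin 2) ℂ} {k : ℕ}
    (hP : MvPolynomial.IsWeightedHomogeneous p P k) : (P : Formal) ∈ hom p k := by
  intro n hn
  rw [MvPolynomial.coeff_coe] at hn
  simp [wt, hP hn]

theorem coeff_X_mul_pderiv (i : Fin 2) (f : Formal) (n : Fin 2 →₀ ℕ) :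
    coeff n (X i * pderiv ℂ i f) = n i * coeff n f := by
  classical
  by_cases h : n i = 0
  · have : (X i : Formal) ∣ X i * pderiv ℂ i f := dvd_mul_right _ _
    rw [X_dvd_iff] at this
    simp [this n h, h]
  · obtain ⟨m, rfl⟩ : ∃ m, n = m + Finsupp.single i 1 := by
      refine ⟨n - Finsupp.single i 1, (tsub_add_cancel_of_le ?_).symm⟩
      simpa [Finsupp.single_le_iff] using Nat.one_le_iff_ne_zero.2 h
    rw [X, add_comm m, coeff_add_monomial_mul, coeff_pderiv]
    simp [add_comm, mul_comm]

/-- The derivation defined by the radial field. -/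
def radialDer (p : Fin 2 → ℕ) : Derivation ℂ Formal Formal :=
  ((p 0 : Formal) * X 0) • pderiv ℂ 0 + ((p 1 : Formal) * X 1) • pderiv ℂ 1

theorem radialDer_apply (f : Formal) :
    radialDer p f =
      (p 0 : Formal) * X 0 * pderiv ℂ 0 f + (p 1 : Formal) * X 1 * pderiv ℂ 1 f := by
  simp [radialDer]

theorem coeff_radialDer (f : Formal) (n : Fin 2 →₀ ℕ) :
    coeff n (radialDer p f) = wt p n * coeff n f := by
  have h (k : ℕ) (g : Formal) : coeff n ((k : Formal) * g) = k * coeff n g := by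
    rw [← nsmul_eq_mul, map_nsmul, nsmul_eq_mul]
  rw [radialDer_apply, mul_assoc, mul_assoc, map_add, h, h, coeff_X_mul_pderiv,
    coeff_X_mul_pderiv, wt_eq]
  push_cast
  ring

theorem radialDer_mem_ws (hf : f ∈ ws p S) : radialDer p f ∈ ws p S := by
  intro n hn
  rw [coeff_radialDer] at hn
  exact hf n (right_ne_zero_of_mul hn)

theorem radialDer_of_mem_hom (hf : f ∈ hom p d) : radialDer p f = (d : ℂ) • f := by
  ext n
  rw [coeff_radialDer, coeff_smul]
  by_cases h : coeff n f = 0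
  · simp [h]
  · rw [show wt p n = d from hf n h]

/-- The quasi-homogeneous component of weight `d`. -/
def homComp (p : Fin 2 → ℕ) (d : ℤ) : Formal →ₗ[ℂ] Formal where
  toFun f := fun n => if wt p n = d then coeff n f else 0
  map_add' f g := by
    funext n
    change (if wt p n = d then coeff n (f + g) else 0) =
      (if wt p n = d then coeff n f else 0) + (if wt p n = d then coeff n g else 0)
    split_ifs <;> simp
  map_smul' a f := by
    funext n
    change (if wt p n = d then coeff n (a • f) else 0) = a * (if wt p n = d then coeff n f else 0)
    split_ifs <;> simp

theorem coeff_homComp (n : Fin 2 →₀ ℕ) : coeff n (homComp p d f) = if wt p n = d then coeff n f else 0 :=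
  rfl

theorem homComp_mem_hom (d : ℤ) (f : Formal) : homComp p d f ∈ hom p d := by
  intro n hn
  rw [coeff_homComp] at hn
  by_contra h
  exact hn (if_neg h)

theorem homComp_of_mem_hom (hf : f ∈ hom p d) : homComp p d f = f := by
  ext n
  rw [coeff_homComp, ite_eq_left_iff]
  intro h
  exact (coeff_eq_zero_of_mem_ws hf h).symm

theorem homComp_of_mem_ws (hf : f ∈ ws p S) (hd : d ∉ S) : homComp p d f = 0 := by
  ext n
  rw [coeff_homComp, map_zero, ite_eq_right_iff]
  rintro rfl
  exact coeff_eq_zero_of_mem_ws hf hd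

theorem sub_homComp_mem (d : ℤ) (f : Formal) : f - homComp p d f ∈ ws p {d}ᶜ := by
  intro n hn h
  rw [map_sub, coeff_homComp, if_pos (by simpa using h), sub_self] at hn
  exact hn rfl

theorem sub_homComp_mem_fil (hf : f ∈ fil p d) : f - homComp p d f ∈ fil p (d + 1) := by
  intro n hn
  rw [map_sub, coeff_homComp] at hn
  split_ifs at hn with h
  · simp at hn
  · rw [sub_zero] at hn
    have := hf n hn
    simp only [Set.mem_Ici] at *
    omega

theorem homComp_mul (hg : g ∈ hom p e) (d : ℤ) (f : Formal) :
    homComp p (d + e) (f * g) = homComp p d f * g := by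
  have h₁ : (f - homComp p d f) * g ∈ ws p {d + e}ᶜ :=
    mul_mem_ws (sub_homComp_mem d f) hg fun s hs t ht => by
      simp only [Set.mem_compl_iff, Set.mem_singleton_iff] at *; omega
  have h₂ := homComp_of_mem_ws h₁ (d := d + e) (by simp)
  rw [sub_mul, map_sub, homComp_of_mem_hom (mul_mem_hom (homComp_mem_hom d f) hg)] at h₂
  exact sub_eq_zero.1 h₂

/-- Multiplication by g shifts each homogeneous component of f by e, and no nonzero component is
killed because the ring is a domain. -/
theorem mem_fil_of_mul_mem_fil (hg : g ∈ hom p e) (hg0 : g ≠ 0) (hf : f * g ∈ fil p (d + e)) :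
    f ∈ fil p d := by
  intro n hn
  by_contra h
  have h₁ := homComp_of_mem_ws hf (d := wt p n + e) (by simp at h ⊢; omega)
  rw [homComp_mul hg] at h₁
  have h₂ := congrArg (coeff n) ((mul_eq_zero.1 h₁).resolve_right hg0)
  rw [coeff_homComp, if_pos rfl] at h₂
  exact hn h₂

end

/-! ### Exponentials of order-raising operators; the diffeomorphism exp(bR). -/

section

variable {p : Fin 2 → ℕ} {f g b b' : Formal} {d e : ℤ} {T T₁ T₂ T₃ : Module.End ℂ Formal}

/-- The operator `T` raises the weighted order by at least one. -/
def Raises (p : Fin 2 → ℕ) (T : Module.End ℂ Formal) : Prop :=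
  ∀ (d : ℤ) (f : Formal), f ∈ fil p d → T f ∈ fil p (d + 1)

theorem Raises.pow_mem (hT : Raises p T) (hf : f ∈ fil p d) (n : ℕ) :
    (T ^ n) f ∈ fil p (d + n) := by
  induction n with
  | zero => simpa using hf
  | succ n ih =>
    rw [pow_succ', Module.End.mul_apply]
    convert hT _ _ ih using 2
    push_cast
    ring

/-- The partial sums of the exponential series of `T`. -/
def expSum (T : Module.End ℂ Formal) (N : ℕ) : Module.End ℂ Formal :=
  ∑ i ∈ Finset.range N, ((i.factorial : ℂ))⁻¹ • T ^ i

theorem expSum_apply (N : ℕ) (f : Formal) :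
    expSum T N f = ∑ i ∈ Finset.range N, ((i.factorial : ℂ))⁻¹ • (T ^ i) f := by
  simp [expSum]

theorem expSum_sub_mem (hT : Raises p T) (hf : f ∈ fil p d) {M N : ℕ} (h : M ≤ N) :
    expSum T N f - expSum T M f ∈ fil p (d + M) := by
  rw [expSum_apply, expSum_apply, ← Finset.sum_Ico_eq_sub _ h]
  refine Submodule.sum_mem _ fun i hi => Submodule.smul_mem _ _ ?_
  exact fil_mono (by simp at hi ⊢; omega) (hT.pow_mem hf i)

theorem expSum_mem (hT : Raises p T) (hf : f ∈ fil p d) (N : ℕ) : expSum T N f ∈ fil p d := by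
  have := expSum_sub_mem hT hf (Nat.zero_le N)
  simpa [expSum] using this

/-- The exponential of an operator that raises the weighted order. -/
def expOp (p : Fin 2 → ℕ) (T : Module.End ℂ Formal) : Module.End ℂ Formal where
  -- When T raises the order, T^i f has no monomial of the weight of n once i exceeds that weight,
  -- so this truncation already gives the final coefficient.
  toFun f := fun n => coeff n (expSum T ((wt p n).toNat + 1) f)
  map_add' f g := by
    funext n
    rw [map_add, map_add]
    rfl
  map_smul' a f := by
    funext n
    rw [map_smul, map_smul]
    rfl

theorem coeff_expOp (f : Formal) (n : Fin 2 →₀ ℕ) :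
    coeff n (expOp p T f) = coeff n (expSum T ((wt p n).toNat + 1) f) := rfl

theorem coeff_expOp_of_lt (hT : Raises p T) (n : Fin 2 →₀ ℕ) {N : ℕ} (hN : wt p n < N) :
    coeff n (expOp p T f) = coeff n (expSum T N f) := by
  have h := expSum_sub_mem hT (mem_fil_zero f) (M := (wt p n).toNat + 1) (N := N)
    (by have := wt_nonneg p n; omega)
  have h' := coeff_eq_zero_of_mem_ws h (n := n) (by simp)
  rw [map_sub] at h'
  rw [coeff_expOp, ← sub_eq_zero.1 h']

theorem expOp_sub_expSum_mem (hT : Raises p T) (hf : f ∈ fil p d) (N : ℕ) :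
    expOp p T f - expSum T N f ∈ fil p (d + N) := by
  intro n hn
  by_contra hlt
  apply hn
  have h := expSum_sub_mem hT hf (le_max_left N ((wt p n).toNat + 1))
  have h' := coeff_eq_zero_of_mem_ws h hlt
  rw [map_sub] at h' ⊢
  rw [coeff_expOp_of_lt hT n (N := max N ((wt p n).toNat + 1)), h']
  have := le_max_right N ((wt p n).toNat + 1)
  omega

/-- The filtration is separated, so a limit of the partial sums is unique. Identities between
exponentials are proved below by checking them on partial sums. -/
theorem eq_expOp (hT : Raises p T) (c : ℤ) (h : ∀ N : ℕ, g - expSum T N f ∈ fil p (c + N)) :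
    g = expOp p T f := by
  rw [← sub_eq_zero]
  refine eq_zero_of_forall_mem_fil (p := p) (min c 0) fun N => ?_
  have h₁ := expOp_sub_expSum_mem hT (mem_fil_zero f) N
  have := Submodule.sub_mem _ (fil_mono (d := min c 0 + N) (by simp) (h N))
    (fil_mono (d := min c 0 + N) (by simp) h₁)
  simpa using this

theorem expOp_eq_self (hT : Raises p T) (h : T f = 0) : expOp p T f = f := by
  refine (eq_expOp hT (-1) fun N => ?_).symm
  cases N with
  | zero => exact mem_fil_of_nonpos (by simp) _
  | succ N =>
    rw [expSum_apply, Finset.sum_range_succ']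
    simp [pow_succ, h]

theorem expOp_mul_left (hT₁ : Raises p T₁) (hT₂ : Raises p T₂)
    (h : ∀ g, T₁ (f * g) = f * T₂ g) (g : Formal) :
    expOp p T₁ (f * g) = f * expOp p T₂ g := by
  have hpow (n : ℕ) : (T₁ ^ n) (f * g) = f * (T₂ ^ n) g := by
    induction n with
    | zero => simp
    | succ n ih => rw [pow_succ', Module.End.mul_apply, ih, h, pow_succ', Module.End.mul_apply]
  refine (eq_expOp hT₁ 0 fun N => ?_).symm
  have := mul_mem_fil (mem_fil_zero f) (expOp_sub_expSum_mem hT₂ (mem_fil_zero g) N)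
  convert this using 1
  · simp
  · rw [mul_sub, expSum_apply, expSum_apply, Finset.mul_sum]
    simp [hpow]

/-- The sum over the square i, j < N and the sum over the triangle i + j < N differ only by terms
with i + j ≥ N. -/
theorem sum_binomial_sub_mem {x : ℕ → ℕ → Formal} (hx : ∀ i j : ℕ, x i j ∈ fil p (i + j)) (N : ℕ) :
    ∑ i ∈ Finset.range N, ∑ j ∈ Finset.range N,
        ((i.factorial : ℂ)⁻¹ * (j.factorial : ℂ)⁻¹) • x i j -
      ∑ n ∈ Finset.range N, (n.factorial : ℂ)⁻¹ •
        ∑ m ∈ Finset.HasAntidiagonal.antidiagonal n, n.choose m.1 • x m.1 m.2 ∈ fil p N := by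
  have h (n : ℕ) : (n.factorial : ℂ)⁻¹ • ∑ m ∈ Finset.HasAntidiagonal.antidiagonal n, n.choose m.1 • x m.1 m.2 =
      ∑ k ∈ Finset.range (n + 1),
        ((k.factorial : ℂ)⁻¹ * ((n - k).factorial : ℂ)⁻¹) • x k (n - k) := by
    rw [Finset.Nat.sum_antidiagonal_eq_sum_range_succ_mk, Finset.smul_sum]
    refine Finset.sum_congr rfl fun k hk => ?_
    have hk' : k ≤ n := by simp at hk; omega
    rw [← Nat.cast_smul_eq_nsmul ℂ, smul_smul, Nat.cast_choose ℂ hk']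
    congr 1
    have := Nat.cast_ne_zero (R := ℂ).2 n.factorial_ne_zero
    have := Nat.cast_ne_zero (R := ℂ).2 k.factorial_ne_zero
    have := Nat.cast_ne_zero (R := ℂ).2 (n - k).factorial_ne_zero
    field_simp
  rw [Finset.sum_congr rfl fun n _ => h n, Finset.sum_range_diag_flip N fun i j =>
    ((i.factorial : ℂ)⁻¹ * (j.factorial : ℂ)⁻¹) • x i j, ← Finset.sum_sub_distrib]
  refine Submodule.sum_mem _ fun i hi => ?_
  rw [← Finset.sum_Ico_eq_sub _ (Nat.sub_le N i)]
  refine Submodule.sum_mem _ fun j hj => Submodule.smul_mem _ _ (fil_mono ?_ (hx i j))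
  simp at hi hj
  omega

/-- Through multiplication, T₃ is intertwined with T₁ ⊗ 1 + 1 ⊗ T₂ on the tensor square; the two
summands commute, so the binomial theorem applies. -/
theorem pow_apply_mul (h : ∀ f g, T₃ (f * g) = T₁ f * g + f * T₂ g) (f g : Formal) (n : ℕ) :
    (T₃ ^ n) (f * g) =
      ∑ m ∈ Finset.HasAntidiagonal.antidiagonal n, n.choose m.1 • ((T₁ ^ m.1) f * (T₂ ^ m.2) g) := by
  set L₁ : Module.End ℂ (TensorProduct ℂ Formal Formal) := LinearMap.rTensor Formal T₁
  set L₂ : Module.End ℂ (TensorProduct ℂ Formal Formal) := LinearMap.lTensor Formal T₂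
  have hcomm : Commute L₁ L₂ := by
    change L₁ ∘ₗ L₂ = L₂ ∘ₗ L₁
    rw [LinearMap.rTensor_comp_lTensor, LinearMap.lTensor_comp_rTensor]
  have hmul : T₃ ∘ₗ LinearMap.mul' ℂ Formal = LinearMap.mul' ℂ Formal ∘ₗ (L₁ + L₂) := by
    ext f g : 3
    simp [L₁, L₂, h]
  have hpow (n : ℕ) (z : TensorProduct ℂ Formal Formal) :
      (T₃ ^ n) (LinearMap.mul' ℂ Formal z) = LinearMap.mul' ℂ Formal (((L₁ + L₂) ^ n) z) := by
    induction n with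
    | zero => simp
    | succ n ih =>
      rw [pow_succ', Module.End.mul_apply, ih, pow_succ', Module.End.mul_apply]
      exact LinearMap.congr_fun hmul _
  have := hpow n (f ⊗ₜ[ℂ] g)
  rw [LinearMap.mul'_apply, hcomm.add_pow'] at this
  rw [this, LinearMap.sum_apply, map_sum]
  refine Finset.sum_congr rfl fun m _ => ?_
  rw [LinearMap.smul_apply, map_nsmul, Module.End.mul_apply, LinearMap.rTensor_pow,
    LinearMap.lTensor_pow, LinearMap.lTensor_tmul, LinearMap.rTensor_tmul, LinearMap.mul'_apply]

theorem expOp_mul (hT₁ : Raises p T₁) (hT₂ : Raises p T₂) (hT₃ : Raises p T₃)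
    (h : ∀ f g, T₃ (f * g) = T₁ f * g + f * T₂ g) (f g : Formal) :
    expOp p T₃ (f * g) = expOp p T₁ f * expOp p T₂ g := by
  refine (eq_expOp hT₃ 0 fun N => ?_).symm
  have h₁ := sum_binomial_sub_mem (p := p) (x := fun i j => (T₁ ^ i) f * (T₂ ^ j) g)
    (fun i j => by
      have := mul_mem_fil (hT₁.pow_mem (mem_fil_zero f) i) (hT₂.pow_mem (mem_fil_zero g) j)
      rwa [zero_add, zero_add] at this) N
  have h₂ : expSum T₁ N f * expSum T₂ N g - expSum T₃ N (f * g) ∈ fil p N := by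
    convert h₁ using 2
    · rw [expSum_apply, expSum_apply, Finset.sum_mul_sum]
      simp only [smul_mul_smul_comm]
    · rw [expSum_apply]
      simp only [pow_apply_mul h]
  have h₃ := mul_mem_fil (expOp_sub_expSum_mem hT₁ (mem_fil_zero f) N)
    (mem_fil_zero (expOp p T₂ g))
  have h₄ := mul_mem_fil (mem_fil_zero (expSum T₁ N f))
    (expOp_sub_expSum_mem hT₂ (mem_fil_zero g) N)
  rw [zero_add] at h₃ h₄ ⊢
  rw [zero_add] at h₄
  rw [add_zero] at h₃
  convert add_mem (add_mem h₃ h₄) h₂ using 1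
  ring

theorem expOp_expOp (hT₁ : Raises p T₁) (hT₂ : Raises p T₂) (hT₃ : Raises p (T₁ + T₂))
    (h : Commute T₁ T₂) (f : Formal) :
    expOp p T₁ (expOp p T₂ f) = expOp p (T₁ + T₂) f := by
  refine eq_expOp hT₃ 0 fun N => ?_
  have h₁ := sum_binomial_sub_mem (p := p) (x := fun i j => (T₁ ^ i) ((T₂ ^ j) f))
    (fun i j => by
      have := hT₁.pow_mem (hT₂.pow_mem (mem_fil_zero f) j) i
      rwa [zero_add, add_comm] at this) N
  have h₂ : expSum T₁ N (expSum T₂ N f) - expSum (T₁ + T₂) N f ∈ fil p N := by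
    convert h₁ using 2
    · rw [expSum_apply, expSum_apply]
      simp [map_sum, Finset.smul_sum, smul_smul]
    · rw [expSum_apply]
      simp [h.add_pow']
  have h₃ := expOp_sub_expSum_mem hT₁ (mem_fil_zero (expOp p T₂ f)) N
  have h₄ := expSum_mem hT₁ (expOp_sub_expSum_mem hT₂ (mem_fil_zero f) N) N
  rw [zero_add] at h₃ h₄ ⊢
  rw [map_sub] at h₄
  convert add_mem (add_mem h₃ h₄) h₂ using 1
  abel

/-- The operator `f ↦ b (R f + z f)`. -/
def twisted (p : Fin 2 → ℕ) (b : Formal) (z : ℂ) : Module.End ℂ Formal :=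
  LinearMap.mulLeft ℂ b ∘ₗ ((radialDer p : Formal →ₗ[ℂ] Formal) + z • LinearMap.id)

theorem twisted_apply (z : ℂ) (f : Formal) :
    twisted p b z f = b * (radialDer p f + z • f) := rfl

theorem twisted_mem {z : ℂ} (hb : b ∈ fil p e) (hf : f ∈ fil p d) :
    twisted p b z f ∈ fil p (e + d) :=
  mul_mem_fil hb (add_mem (radialDer_mem_ws hf) (Submodule.smul_mem _ _ hf))

theorem raises_twisted (hb : b ∈ fil p 1) (z : ℂ) : Raises p (twisted p b z) := fun d f hf => by
  rw [add_comm]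
  exact twisted_mem hb hf

/-- The exponential of `f ↦ b (R f + z f)`. -/
abbrev expTw (p : Fin 2 → ℕ) (b : Formal) (z : ℂ) : Module.End ℂ Formal :=
  expOp p (twisted p b z)

/-- The operators b(R + z), b(R + w) and b(R + z + w) satisfy a Leibniz rule together. Thus `expTw p
b z 1` behaves as the power U^z, for complex z. -/
theorem expTw_mul (hb : b ∈ fil p 1) (z w : ℂ) (f g : Formal) :
    expTw p b (z + w) (f * g) = expTw p b z f * expTw p b w g := by
  refine expOp_mul (raises_twisted hb z) (raises_twisted hb w) (raises_twisted hb _)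
    (fun f g => ?_) f g
  simp only [twisted_apply, Derivation.leibniz, smul_eq_mul, smul_eq_C_mul, map_add]
  ring

theorem expTw_one (hb : b ∈ fil p 1) : expTw p b 0 1 = 1 :=
  expOp_eq_self (raises_twisted hb 0) (by simp [twisted_apply])

theorem expTw_add_one (hb : b ∈ fil p 1) (z w : ℂ) :
    expTw p b (z + w) 1 = expTw p b z 1 * expTw p b w 1 := by
  rw [← expTw_mul hb, one_mul]

theorem expTw_eq_mul (hb : b ∈ fil p 1) (z : ℂ) (f : Formal) :
    expTw p b z f = expTw p b 0 f * expTw p b z 1 := by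
  rw [← expTw_mul hb, mul_one, zero_add]

theorem expTw_natCast (hb : b ∈ fil p 1) (k : ℕ) : expTw p b k 1 = expTw p b 1 1 ^ k := by
  induction k with
  | zero => simpa using expTw_one hb
  | succ k ih => rw [Nat.cast_succ, expTw_add_one hb, ih, pow_succ]

/-- As R(f g) = f (R + k)(g), multiplication by f carries b(R + k) to bR; exponentiate and apply to
1. -/
theorem expTw_of_mem_hom (hb : b ∈ fil p 1) {k : ℕ} (hf : f ∈ hom p k) :
    expTw p b 0 f = f * expTw p b 1 1 ^ k := by
  rw [← expTw_natCast hb]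
  have := expOp_mul_left (f := f) (raises_twisted hb 0) (raises_twisted hb k) (fun g => ?_) 1
  · rwa [mul_one] at this
  · simp only [twisted_apply, Derivation.leibniz, smul_eq_mul, radialDer_of_mem_hom hf,
      smul_eq_C_mul]
    simp
    ring

/-- The algebra endomorphism `exp (b R)`. -/
def expAlgHom (b : Formal) (hb : b ∈ fil p 1) : Formal →ₐ[ℂ] Formal :=
  AlgHom.ofLinearMap (A := Formal) (B := Formal) (expTw p b 0) (expTw_one hb) fun f g => by
    simpa only [add_zero] using expTw_mul hb 0 0 f g

/-- The formal diffeomorphism `exp (b R)`. -/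
def expEquiv (p : Fin 2 → ℕ) (b : Formal) (hb : b ∈ fil p 1) : FormalDiffeo :=
  have hb' : -b ∈ fil p 1 := neg_mem hb
  have key (b : Formal) (hb : b ∈ fil p 1) (f : Formal) :
      expTw p (-b) 0 (expTw p b 0 f) = f := by
    have h₀ : twisted p (-b) 0 = -twisted p b 0 := by ext1; simp [twisted_apply]
    have h₁ : Raises p (twisted p (-b) 0 + twisted p b 0) := by
      rw [h₀, neg_add_cancel]
      exact fun d f _ => zero_mem _
    rw [expTw, expTw, expOp_expOp (raises_twisted (neg_mem hb) 0) (raises_twisted hb 0) h₁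
      (by rw [h₀]; exact Commute.neg_left (Commute.refl (twisted p b 0)))]
    exact expOp_eq_self h₁ (by simp [h₀])
  AlgEquiv.ofAlgHom (expAlgHom b hb) (expAlgHom (-b) hb')
    (AlgHom.ext fun f => by
      have := key (-b) hb' f
      rwa [neg_neg] at this)
    (AlgHom.ext fun f => key b hb f)

theorem expEquiv_apply (hb : b ∈ fil p 1) (f : Formal) : expEquiv p b hb f = expTw p b 0 f := rfl

theorem isFibred_expEquiv (hb : b ∈ fil p 1) : (expEquiv p b hb).IsFibred p := by
  refine ⟨b, constantCoeff_eq_zero_of_mem_fil_one hb, fun f m => ?_⟩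
  have hact : (FormalField.act fun i => b * radial p i) = twisted p b 0 := by
    funext f
    simp only [FormalField.act, radial, Fin.sum_univ_two, twisted_apply, radialDer_apply,
      zero_smul, add_zero]
    ring
  have hT := raises_twisted hb 0
  rw [expEquiv_apply, expTw, coeff_expOp, expSum_apply, map_sum]
  simp only [coeff_smul, hact, Module.End.pow_apply]
  refine hasSum_sum_of_ne_finset_zero fun n hn => ?_
  have := hT.pow_mem (mem_fil_zero f) n
  rw [Module.End.pow_apply] at this
  rw [coeff_eq_zero_of_mem_ws this, mul_zero]
  have := wt_nonneg p m
  simp at hn ⊢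
  omega

theorem twisted_pow_sub_mem {k : ℕ} {z : ℂ} (hb : b ∈ fil p 1) (hb' : b' ∈ fil p 1)
    (h : b' - b ∈ fil p (k + 1)) (hf : f ∈ fil p d) (n : ℕ) :
    (twisted p b' z ^ n) f - (twisted p b z ^ n) f ∈ fil p (d + k + n) := by
  induction n with
  | zero => simp
  | succ n ih =>
    have h₁ := raises_twisted hb' z _ _ ih
    have h₂ := twisted_mem (z := z) h ((raises_twisted hb z).pow_mem hf n)
    rw [pow_succ', pow_succ', Module.End.mul_apply, Module.End.mul_apply]
    convert add_mem h₁ (fil_mono (d := d + k + n + 1) (by omega) h₂) using 1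
    · push_cast
      ring_nf
    · simp only [map_sub, twisted_apply]
      ring

/-- The n-th powers of the two operators differ by order k + n, so only the term n = 1 is visible
below order d + k + 2. -/
theorem expTw_sub_sub_mem {k : ℕ} (z : ℂ) (hb : b ∈ fil p 1) (hb' : b' ∈ fil p 1)
    (h : b' - b ∈ fil p (k + 1)) (hf : f ∈ fil p d) :
    expTw p b' z f - expTw p b z f - twisted p (b' - b) z f ∈ fil p (d + k + 2) := by
  have h₁ := expOp_sub_expSum_mem (raises_twisted hb' z) hf (k + 2)
  have h₂ := expOp_sub_expSum_mem (raises_twisted hb z) hf (k + 2)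
  have h₃ : expSum (twisted p b' z) (k + 2) f - expSum (twisted p b z) (k + 2) f -
      twisted p (b' - b) z f ∈ fil p (d + k + 2) := by
    rw [expSum_apply, expSum_apply, ← Finset.sum_sub_distrib, Finset.sum_range_succ',
      Finset.sum_range_succ']
    have : ∑ i ∈ Finset.range k, (((i + 1 + 1).factorial : ℂ)⁻¹ • (twisted p b' z ^ (i + 1 + 1)) f -
        ((i + 1 + 1).factorial : ℂ)⁻¹ • (twisted p b z ^ (i + 1 + 1)) f) ∈ fil p (d + k + 2) := by
      refine Submodule.sum_mem _ fun i _ => ?_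
      rw [← smul_sub]
      refine Submodule.smul_mem _ _ (fil_mono ?_ (twisted_pow_sub_mem hb hb' h hf (i + 1 + 1)))
      push_cast
      omega
    convert this using 1
    simp [twisted_apply]
    ring
  push_cast at h₁ h₂
  rw [← add_assoc] at h₁ h₂
  convert add_mem (sub_mem h₁ h₂) h₃ using 1
  abel

theorem expTw_sub_mem {k : ℕ} (z : ℂ) (hb : b ∈ fil p 1) (hb' : b' ∈ fil p 1)
    (h : b' - b ∈ fil p (k + 1)) (hf : f ∈ fil p d) :
    expTw p b' z f - expTw p b z f ∈ fil p (d + k + 1) := by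
  have := add_mem (fil_mono (by omega) (expTw_sub_sub_mem z hb hb' h hf))
    (fil_mono (d := d + k + 1) (by omega) (twisted_mem (z := z) h hf))
  simpa using this

end

/-! ### Consequences of the isolated singularity. -/

section

variable {p : Fin 2 → ℕ} {f g h : Formal} {δ : ℕ}

theorem exists_X_pow_mem (I : Ideal Formal) [Module.Finite ℂ (Formal ⧸ I)] (i : Fin 2) :
    ∃ n : ℕ, (X i : Formal) ^ n ∈ I := by
  obtain ⟨P, hP, hP0⟩ := Algebra.IsIntegral.isIntegral (R := ℂ) (Ideal.Quotient.mk I (X i))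
  obtain ⟨q, hq, hq0⟩ := Polynomial.exists_eq_pow_rootMultiplicity_mul_and_not_dvd P hP.ne_zero 0
  have hmem : Polynomial.aeval (X i : Formal) P ∈ I := by
    rw [← Ideal.Quotient.eq_zero_iff_mem, ← Ideal.Quotient.mkₐ_eq_mk ℂ, ← Polynomial.aeval_algHom_apply]
    exact hP0
  -- With the factors X removed from the annihilating polynomial, q(0) ≠ 0; so q(xᵢ) is invertible
  -- and the power of xᵢ alone lies in I.
  have hu : IsUnit (Polynomial.aeval (X i : Formal) q) := by
    rw [isUnit_iff_constantCoeff, isUnit_iff_ne_zero]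
    intro h0
    apply hq0
    rw [Polynomial.dvd_iff_isRoot, Polynomial.IsRoot.def]
    have key : (constantCoeff (σ := Fin 2) (R := ℂ)) (Polynomial.aeval (X i : Formal) q) =
        Polynomial.eval 0 q := by
      rw [Polynomial.aeval_def, Polynomial.hom_eval₂, constantCoeff_X]
      have : (constantCoeff (σ := Fin 2) (R := ℂ)).comp (algebraMap ℂ Formal) = RingHom.id ℂ := by
        ext z
        simp [MvPowerSeries.algebraMap_apply]
      rw [this, Polynomial.eval₂_id]
    rw [← key, h0]
  refine ⟨P.rootMultiplicity 0, ?_⟩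
  rw [hq, map_mul, map_pow, map_sub, Polynomial.aeval_X, Polynomial.aeval_C, map_zero, sub_zero,
    mul_comm, Ideal.unit_mul_mem_iff_mem _ hu] at hmem
  exact hmem

theorem X_pow_dvd_of_dvd_X_pow_mul {i j : Fin 2} (hij : i ≠ j) {k l : ℕ}
    (hf : (X i : Formal) ^ k ∣ X j ^ l * f) : (X i : Formal) ^ k ∣ f := by
  rw [X_pow_dvd_iff] at hf ⊢
  intro m hm
  have := hf (Finsupp.single j l + m) (by simpa [hij] using hm)
  rwa [X_pow_eq, coeff_add_monomial_mul, one_mul] at this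

theorem not_jacobianIdeal_le_span_X [Module.Finite ℂ (Formal ⧸ jacobianIdeal h)] (j : Fin 2) :
    ¬ jacobianIdeal h ≤ Ideal.span {X j} := by
  intro hle
  obtain ⟨n, hn⟩ := exists_X_pow_mem (jacobianIdeal h) (j + 1)
  have hn' := Ideal.mem_span_singleton.1 (hle hn)
  rw [X_dvd_iff] at hn'
  have := hn' (Finsupp.single (j + 1) n) (by simp)
  rw [coeff_X_pow] at this
  simp at this

theorem ne_zero_of_finite [Module.Finite ℂ (Formal ⧸ jacobianIdeal h)] : h ≠ 0 := by
  rintro rfl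
  refine not_jacobianIdeal_le_span_X (h := 0) 0 ?_
  rw [jacobianIdeal, Ideal.span_le]
  rintro _ ⟨i, rfl⟩
  simp

/-- In weight 0 a variable of positive weight cannot occur, so h depends on the other variable only.
Being critical at 0 then puts the whole Jacobian ideal inside the ideal of that variable, which has
infinite codimension. -/
theorem weight_pos_of_hasIsolatedSingularity (hp : Nat.Coprime (p 0) (p 1))
    (hh : h ∈ hom p δ) (hsing : HasIsolatedSingularity h) : 0 < δ := by
  have := hsing.2
  by_contra hδ
  obtain rfl : δ = 0 := by omega
  obtain ⟨i, hi⟩ : ∃ i, p i ≠ 0 := by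
    by_contra! hall
    simp [hall] at hp
  have hi0 : pderiv ℂ i h = 0 := eq_zero_of_mem_hom_neg (by simp; omega) (pderiv_mem_hom i hh)
  refine not_jacobianIdeal_le_span_X (h := h) (i + 1) ?_
  rw [jacobianIdeal, Ideal.span_le]
  rintro _ ⟨j, rfl⟩
  simp only [SetLike.mem_coe, Ideal.mem_span_singleton]
  by_cases hj : j = i
  · simp [hj, hi0]
  obtain rfl : j = i + 1 := by fin_cases i <;> fin_cases j <;> simp_all
  rw [X_dvd_iff]
  intro m hm
  by_contra hc
  have hm0 : m = 0 := by
    have h₁ : coeff (m + Finsupp.single (i + 1) 1) h ≠ 0 := by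
      rw [coeff_pderiv] at hc
      exact left_ne_zero_of_mul hc
    have h₂ : wt p (m + Finsupp.single (i + 1) 1) = 0 := by simpa using hh _ h₁
    have h₃ : m i = 0 := by
      rw [wt_eq] at h₂
      have hpi : 0 < p i := Nat.pos_of_ne_zero hi
      have : (m i : ℤ) * p i ≤ 0 := by
        rw [← h₂]
        fin_cases i <;> simp
      have : m i * p i = 0 := by
        have h₄ : ((m i * p i : ℕ) : ℤ) ≤ 0 := by push_cast; exact this
        omega
      exact (Nat.mul_eq_zero.1 this).resolve_right hi
    ext l
    by_cases hl : l = i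
    · simp [hl, h₃]
    · obtain rfl : l = i + 1 := by fin_cases i <;> fin_cases l <;> simp_all
      simp [hm]
  rw [hm0, coeff_zero_eq_constantCoeff_apply] at hc
  exact hc (hsing.1 _)

/-- The Jacobian ideal contains x^m and y^n, so x^m f = h P and y^n f = h Q. Then y^n P = x^m Q
forces x^m to divide P, and x^m cancels. -/
theorem dvd_of_dvd_pderiv_mul [Module.Finite ℂ (Formal ⧸ jacobianIdeal h)]
    (hf : ∀ i, h ∣ pderiv ℂ i h * f) : h ∣ f := by
  have hJ : ∀ a ∈ jacobianIdeal h, h ∣ a * f := by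
    intro a ha
    refine Submodule.span_induction ?_ (by simp) (fun x y _ _ hx hy => ?_)
      (fun r x _ hx => ?_) ha
    · rintro _ ⟨i, rfl⟩
      exact hf i
    · rw [add_mul]
      exact dvd_add hx hy
    · rw [smul_eq_mul, mul_assoc]
      exact hx.mul_left r
  obtain ⟨m, hm⟩ := exists_X_pow_mem (jacobianIdeal h) 0
  obtain ⟨n, hn⟩ := exists_X_pow_mem (jacobianIdeal h) 1
  obtain ⟨P, hP⟩ := hJ _ hm
  obtain ⟨Q, hQ⟩ := hJ _ hn
  have hne := ne_zero_of_finite (h := h)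
  have hPQ : X 1 ^ n * P = X 0 ^ m * Q := by
    apply mul_left_cancel₀ hne
    linear_combination -(X 1 ^ n) * hP + X 0 ^ m * hQ
  obtain ⟨P', rfl⟩ := X_pow_dvd_of_dvd_X_pow_mul (i := 0) (j := 1) (by decide)
    (Dvd.intro Q hPQ.symm)
  have hX : (X 0 : Formal) ≠ 0 := fun h0 => by
    have := congrArg (coeff (Finsupp.single 0 1)) h0
    simp [coeff_index_single_self_X] at this
  refine ⟨P', mul_left_cancel₀ (pow_ne_zero m hX) ?_⟩
  linear_combination hP

end

/-! ### The homological equation: solving f = H(g) + ∑ dᵢ(h) aᵢ in each weight. -/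

section

variable {p : Fin 2 → ℕ} {f g h : Formal} {δ : ℕ}

theorem exists_coeff_eq (F : (Fin 2 →₀ ℕ) → ℂ) : ∃ g : Formal, ∀ n, coeff n g = F n :=
  ⟨F, fun _ => rfl⟩

/-- Integration in a variable of weight zero preserves the weight. -/
theorem exists_pderiv_eq {i : Fin 2} (hi : p i = 0) {d : ℤ} (hf : f ∈ hom p d) :
    ∃ g ∈ hom p d, pderiv ℂ i g = f := by
  classical
  obtain ⟨g, hg⟩ : ∃ g : Formal, ∀ n, coeff n g =
      if n i = 0 then 0 else coeff (n - Finsupp.single i 1) f / n i :=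
    exists_coeff_eq _
  refine ⟨g, ?_, ?_⟩
  · intro n hn
    rw [hg] at hn
    by_cases h0 : n i = 0
    · simp [h0] at hn
    · rw [if_neg h0] at hn
      have h₁ : wt p (n - Finsupp.single i 1) = d := by
        simpa using hf _ (div_ne_zero_iff.1 hn).1
      have h₂ : n = n - Finsupp.single i 1 + Finsupp.single i 1 :=
        (tsub_add_cancel_of_le (by
          simpa [Finsupp.single_le_iff] using Nat.one_le_iff_ne_zero.2 h0)).symm
      rw [h₂, wt_add, h₁, wt_single, hi]
      simp
  · ext n
    rw [coeff_pderiv, hg, if_neg (by simp), add_tsub_cancel_right]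
    have : ((n i : ℂ) + 1) ≠ 0 := by exact_mod_cast Nat.succ_ne_zero (n i)
    simp
    field_simp

/-- The Hamiltonian derivation `f ↦ h_x f_y - h_y f_x`. -/
def hamDer (h : Formal) : Derivation ℂ Formal Formal :=
  pderiv ℂ 0 h • pderiv ℂ 1 - pderiv ℂ 1 h • pderiv ℂ 0

theorem hamDer_apply (h f : Formal) :
    hamDer h f = pderiv ℂ 0 h * pderiv ℂ 1 f - pderiv ℂ 1 h * pderiv ℂ 0 f := rfl

theorem hamDer_self (h : Formal) : hamDer h h = 0 := by
  rw [hamDer_apply]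
  ring

theorem hamDer_mem_fil {d : ℤ} (hh : h ∈ hom p δ) (hf : f ∈ fil p d) :
    hamDer h f ∈ fil p (d + δ - p 0 - p 1) := by
  have h₀ := mul_mem_fil (hom_le_fil _ (pderiv_mem_hom 0 hh)) (pderiv_mem_fil 1 hf)
  have h₁ := mul_mem_fil (hom_le_fil _ (pderiv_mem_hom 1 hh)) (pderiv_mem_fil 0 hf)
  exact sub_mem (fil_mono (by omega) h₀) (fil_mono (by omega) h₁)

theorem euler (hh : f ∈ hom p δ) :
    (p 0 : Formal) * X 0 * pderiv ℂ 0 f + (p 1 : Formal) * X 1 * pderiv ℂ 1 f = (δ : Formal) * f := by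
  rw [← radialDer_apply, radialDer_of_mem_hom hh, smul_eq_C_mul]
  simp

theorem euler' {d : ℤ} (hh : f ∈ hom p d) :
    (p 0 : Formal) * X 0 * pderiv ℂ 0 f + (p 1 : Formal) * X 1 * pderiv ℂ 1 f = (d : Formal) * f := by
  rw [← radialDer_apply, radialDer_of_mem_hom hh, smul_eq_C_mul]
  simp

theorem pderiv_X_zero_one : pderiv ℂ 0 (X 1 : Formal) = 0 := pderiv_X_of_ne (by decide)

theorem pderiv_X_one_zero : pderiv ℂ 1 (X 0 : Formal) = 0 := pderiv_X_of_ne (by decide)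

theorem pderiv_natCast (i : Fin 2) (k : ℕ) : pderiv ℂ i (k : Formal) = 0 := by
  simp

theorem jacobian_combination_eq (hp : Nat.Coprime (p 0) (p 1)) (hh : h ∈ hom p δ) {m : ℤ}
    {A₀ A₁ : Formal} (hA₀ : A₀ ∈ hom p (m - δ + p 0)) (hA₁ : A₁ ∈ hom p (m - δ + p 1)) :
    ∃ g ∈ hom p (m - δ + p 0 + p 1), ∃ q ∈ hom p (m - δ),
      A₀ * pderiv ℂ 0 h + A₁ * pderiv ℂ 1 h = hamDer h g + h * q := by
  set N : ℤ := m - δ + p 0 + p 1 with hN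
  -- Here A₀ and A₁ have weights -p₁ and -p₀, so a coefficient survives only if the opposite
  -- variable has weight zero; it is then integrated in that variable, with q = 0.
  by_cases hN0 : N = 0
  · have hcase : ∀ i, p i = 0 → p (i + 1) ≠ 0 := by
      intro i hi hi'
      fin_cases i <;> simp_all
    by_cases h₁ : p 1 = 0
    · have h₀ := hcase 1 h₁
      simp only [Fin.isValue, Fin.reduceAdd] at h₀
      have hz : A₁ = 0 := eq_zero_of_mem_hom_neg (by simp at h₀; omega) hA₁
      obtain ⟨g, hg, rfl⟩ := exists_pderiv_eq h₁ hA₀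
      refine ⟨g, by convert hg using 2; omega, 0, zero_mem _, ?_⟩
      have hg' : pderiv ℂ 0 g = 0 :=
        eq_zero_of_mem_hom_neg (by simp at h₀; omega) (pderiv_mem_hom 0 hg)
      rw [hamDer_apply, hg', hz]
      ring
    · have hz : A₀ = 0 := eq_zero_of_mem_hom_neg (by omega) hA₀
      by_cases h₀ : p 0 = 0
      · obtain ⟨g, hg, hgA⟩ := exists_pderiv_eq h₀ (neg_mem hA₁)
        refine ⟨g, by convert hg using 2; omega, 0, zero_mem _, ?_⟩
        have hg' : pderiv ℂ 1 g = 0 :=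
          eq_zero_of_mem_hom_neg (by omega) (pderiv_mem_hom 1 hg)
        rw [hamDer_apply, hg', hz, hgA]
        ring
      · have hz' : A₁ = 0 := eq_zero_of_mem_hom_neg (by omega) hA₁
        exact ⟨0, zero_mem _, 0, zero_mem _, by simp [hz, hz']⟩
  · have hC : C (N : ℂ)⁻¹ * (N : Formal) = 1 := by
      rw [← map_intCast (C : ℂ →+* Formal), ← map_mul, inv_mul_cancel₀, map_one]
      exact_mod_cast hN0
    -- Up to the factor 1/N, g is the determinant of the field A with R, and q is δ times the
    -- divergence of A. The identity follows from Euler's relation for h, A₀ and A₁.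
    refine ⟨C (N : ℂ)⁻¹ * ((p 1 : Formal) * (X 1 * A₀) - (p 0 : Formal) * (X 0 * A₁)), ?_,
      C (N : ℂ)⁻¹ * ((δ : Formal) * (pderiv ℂ 0 A₀ + pderiv ℂ 1 A₁)), ?_, ?_⟩
    · rw [← smul_eq_C_mul, ← nsmul_eq_mul, ← nsmul_eq_mul]
      have h₀ := mul_mem_hom (X_mem_hom 1) hA₀
      have h₁ := mul_mem_hom (X_mem_hom 0) hA₁
      rw [show (p 1 : ℤ) + (m - δ + p 0) = N by omega] at h₀
      rw [show (p 0 : ℤ) + (m - δ + p 1) = N by omega] at h₁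
      exact Submodule.smul_mem _ _ (sub_mem (nsmul_mem h₀ _) (nsmul_mem h₁ _))
    · rw [← smul_eq_C_mul, ← nsmul_eq_mul]
      have h₀ := pderiv_mem_hom 0 hA₀
      have h₁ := pderiv_mem_hom 1 hA₁
      rw [add_sub_cancel_right] at h₀ h₁
      exact Submodule.smul_mem _ _ (nsmul_mem (add_mem h₀ h₁) _)
    · have e := euler hh
      have e₀ := euler' hA₀
      have e₁ := euler' hA₁
      rw [← smul_eq_C_mul, ← smul_eq_C_mul, Derivation.map_smul, smul_eq_C_mul, smul_eq_C_mul,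
        hamDer_apply]
      simp only [map_sub, Derivation.leibniz, smul_eq_mul, pderiv_natCast, pderiv_X_self,
        pderiv_X_zero_one, pderiv_X_one_zero]
      have hNc : (N : Formal) = (m : Formal) - δ + p 0 + p 1 := by
        rw [hN]
        push_cast
        ring
      rw [hNc] at hC
      push_cast at e₀ e₁
      linear_combination (C (N : ℂ)⁻¹ * (pderiv ℂ 0 A₀ + pderiv ℂ 1 A₁)) * e -
        C (N : ℂ)⁻¹ * pderiv ℂ 0 h * e₀ - C (N : ℂ)⁻¹ * pderiv ℂ 1 h * e₁ -
        (A₀ * pderiv ℂ 0 h + A₁ * pderiv ℂ 1 h) * hC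

/-- The series `∑ᵢ dᵢ(h) aᵢ`. -/
def comb (h : Formal) {μ : ℕ} (a : Fin μ → Formal) (d : Fin μ → PowerSeries ℂ) : Formal :=
  ∑ i, PowerSeries.subst h (d i) * a i

theorem comb_add (hs : PowerSeries.HasSubst h) {μ : ℕ} (a : Fin μ → Formal)
    (d d' : Fin μ → PowerSeries ℂ) : comb h a (d + d') = comb h a d + comb h a d' := by
  simp [comb, PowerSeries.subst_add hs, add_mul, Finset.sum_add_distrib]

theorem comb_sub (hs : PowerSeries.HasSubst h) {μ : ℕ} (a : Fin μ → Formal)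
    (d d' : Fin μ → PowerSeries ℂ) : comb h a (d - d') = comb h a d - comb h a d' := by
  simp [comb, PowerSeries.subst_sub hs, sub_mul, Finset.sum_sub_distrib]

theorem comb_mem_fil (hs : PowerSeries.HasSubst h) (hh : h ∈ hom p δ) {μ : ℕ}
    {a : Fin μ → Formal} {e : Fin μ → ℕ} (ha : ∀ i, a i ∈ hom p (e i))
    {d : Fin μ → PowerSeries ℂ} {c : ℤ}
    (hd : ∀ i j, PowerSeries.coeff j (d i) ≠ 0 → c ≤ j * δ + e i) : comb h a d ∈ fil p c := by
  refine Submodule.sum_mem _ fun i _ => ?_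
  have : PowerSeries.subst h (d i) ∈ fil p (c - e i) := by
    intro n hn
    rw [PowerSeries.coeff_subst hs] at hn
    obtain ⟨j, hj⟩ : ∃ j, PowerSeries.coeff j (d i) • coeff n (h ^ j) ≠ 0 := by
      by_contra! hall
      exact hn (finsum_eq_zero_of_forall_eq_zero hall)
    have h₁ := pow_mem_hom hh j n (right_ne_zero_of_smul hj)
    have h₂ := hd i j (left_ne_zero_of_smul hj)
    simp only [Set.mem_singleton_iff, Set.mem_Ici] at *
    omega
  convert mul_mem_fil this (hom_le_fil _ (ha i)) using 2
  ring

theorem exists_homogeneous_decomposition (hp : Nat.Coprime (p 0) (p 1)) (hδ : 0 < δ)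
    (hh : h ∈ hom p δ) (hs : PowerSeries.HasSubst h) {μ : ℕ} {a : Fin μ → Formal} {e : Fin μ → ℕ}
    (ha : ∀ i, a i ∈ hom p (e i))
    (hspan : ∀ f : Formal, ∃ c : Fin μ → ℂ, f - ∑ i, c i • a i ∈ jacobianIdeal h) (M : ℕ) :
    ∀ (m : ℤ) (_ : m < M) (f : Formal) (_ : f ∈ hom p m),
      ∃ g ∈ hom p (m - δ + p 0 + p 1), ∃ d : Fin μ → PowerSeries ℂ,
        (∀ i j, PowerSeries.coeff j (d i) ≠ 0 → (j * δ + e i : ℤ) = m) ∧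
        f = hamDer h g + comb h a d := by
  induction M with
  | zero =>
    intro m hm f hf
    refine ⟨0, zero_mem _, 0, by simp, ?_⟩
    rw [eq_zero_of_mem_hom_neg (by simpa using hm) hf]
    simp [comb, ← PowerSeries.coe_substAlgHom hs]
  | succ M ih =>
    intro m hm f hf
    obtain ⟨c, hc⟩ := hspan f
    rw [jacobianIdeal, show (Set.range fun i => pderiv ℂ i h) = {pderiv ℂ 0 h, pderiv ℂ 1 h} by
      ext; simp [Fin.exists_fin_two, eq_comm], Ideal.mem_span_pair] at hc
    obtain ⟨B₀, B₁, hB⟩ := hc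
    -- Taking the component of weight m makes the cofactors homogeneous and keeps only the aᵢ of
    -- weight m.
    have hB' := congrArg (homComp p m) hB
    have h₀ := homComp_mul (pderiv_mem_hom 0 hh) (m - δ + p 0) B₀
    have h₁ := homComp_mul (pderiv_mem_hom 1 hh) (m - δ + p 1) B₁
    rw [show m - δ + p 0 + (δ - p 0) = m by ring] at h₀
    rw [show m - δ + p 1 + (δ - p 1) = m by ring] at h₁
    rw [map_add, h₀, h₁, map_sub, homComp_of_mem_hom hf, map_sum] at hB'
    obtain ⟨g, hg, q, hq, hgq⟩ := jacobian_combination_eq hp hh (m := m)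
      (homComp_mem_hom (m - δ + p 0) B₀) (homComp_mem_hom (m - δ + p 1) B₁)
    obtain ⟨g', hg', d, hd, hq'⟩ := ih (m - δ) (by omega) q hq
    -- H(h) = 0, so h H(g') = H(h g'); multiplying the combination for q by h multiplies each dᵢ by
    -- t.
    refine ⟨g + h * g', add_mem hg ?_,
      (fun i => PowerSeries.C (if (e i : ℤ) = m then c i else 0)) + fun i => PowerSeries.X * d i,
      ?_, ?_⟩
    · convert mul_mem_hom hh hg' using 2
      ring
    · intro i j hj
      cases j with
      | zero =>
        by_contra hne
        simp at hne
        simp [hne] at hj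
      | succ j =>
        simp [PowerSeries.coeff_succ_X_mul] at hj
        have := hd i j hj
        push_cast
        linarith
    · have hX : comb h a (fun i => PowerSeries.X * d i) = h * comb h a d := by
        simp [comb, PowerSeries.subst_mul hs, PowerSeries.subst_X hs, Finset.mul_sum, mul_assoc]
      have hCc : comb h a (fun i => PowerSeries.C (if (e i : ℤ) = m then c i else 0)) =
          ∑ i, homComp p m (c i • a i) := by
        refine Finset.sum_congr rfl fun i _ => ?_
        rw [PowerSeries.subst_C, ← smul_eq_C_mul, map_smul]
        split_ifs with hi
        · rw [← hi, homComp_of_mem_hom (ha i)]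
        · rw [homComp_of_mem_ws (ha i) (by simpa using Ne.symm hi), zero_smul, smul_zero]
      rw [comb_add hs, hX, hCc, map_add, Derivation.leibniz, hamDer_self]
      simp only [smul_eq_mul, mul_zero, add_zero]
      linear_combination -hB' + hgq + h * hq'

end

/-! ### Successive approximation for the residue equation. -/

section

variable {p : Fin 2 → ℕ} {f g h b b' c : Formal} {δ : ℕ} {μ : ℕ} {a : Fin μ → Formal}
  {e : Fin μ → ℕ} {d d' : Fin μ → PowerSeries ℂ}

/-- Tuples `d` such that all the terms of `∑ᵢ dᵢ(h) aᵢ` have weight at least `k`, if `h` has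
weight `δ` and `aᵢ` has weight `eᵢ`. -/
def combFil (δ : ℕ) (e : Fin μ → ℕ) (k : ℤ) : Submodule ℂ (Fin μ → PowerSeries ℂ) where
  carrier := {d | ∀ i j, PowerSeries.coeff j (d i) ≠ 0 → k ≤ j * δ + e i}
  add_mem' {d d'} hd hd' i j hj := by
    by_cases h0 : PowerSeries.coeff j (d i) = 0
    · exact hd' i j fun h' => hj (by simp [h0, h'])
    · exact hd i j h0
  zero_mem' i j hj := by simp at hj
  smul_mem' z d hd i j hj := hd i j fun h0 => hj (by simp [h0])

theorem combFil_mono {k l : ℤ} (hkl : k ≤ l) : combFil δ e l ≤ combFil δ e k :=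
  fun _ hd i j hj => hkl.trans (hd i j hj)

/-- The weight of the terms of `f dx ∧ dy / h` is `k` if `f` has weight `level p δ k`. -/
def level (p : Fin 2 → ℕ) (δ : ℕ) (k : ℤ) : ℤ := δ - p 0 - p 1 + k

/-- The obstruction to `exp (b R)` carrying `ω₀ + c ω_R` to a multiple of
`ω₀ + ∑ᵢ dᵢ(h) aᵢ ω_R`. -/
def residue (p : Fin 2 → ℕ) (δ : ℕ) (h c : Formal) (a : Fin μ → Formal) (b : Formal)
    (d : Fin μ → PowerSeries ℂ) : Formal :=
  (δ : ℂ)⁻¹ • hamDer h (expTw p b 1 1) + expTw p b (p 0 + p 1 + 1 - δ) c -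
    (expTw p b 1 1 + radialDer p (expTw p b 1 1)) * comb h a d

theorem expTw_one_sub_one_mem (hb : b ∈ fil p 1) : expTw p b 1 1 - 1 ∈ fil p 1 := by
  have := expOp_sub_expSum_mem (raises_twisted hb 1) (mem_fil_zero 1) 1
  simpa [expSum] using this

/-- U changes by b' - b up to order k + 2. All other corrections gain one order, because c and ∑
d'ᵢ(h) aᵢ start at `level p δ 1` and U - 1 has order at least 1. -/
theorem residue_sub_sub_mem (hh : h ∈ hom p δ) (hs : PowerSeries.HasSubst h)
    (ha : ∀ i, a i ∈ hom p (e i)) (hc : c ∈ fil p (level p δ 1)) {k : ℕ}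
    (hb : b ∈ fil p 1) (hb' : b' ∈ fil p 1) (hbb : b' - b ∈ fil p (k + 1))
    (hd' : d' ∈ combFil δ e (level p δ 1))
    (hdd : d' - d ∈ combFil δ e (level p δ (k + 1))) :
    residue p δ h c a b' d' - residue p δ h c a b d -
      ((δ : ℂ)⁻¹ • hamDer h (b' - b) - comb h a (d' - d)) ∈ fil p (level p δ (k + 2)) := by
  unfold level at *
  set E := expTw p b 1 1
  set E' := expTw p b' 1 1
  have h₁ : E' - E - (b' - b) ∈ fil p (k + 2) := by
    have := expTw_sub_sub_mem 1 hb hb' hbb (mem_fil_zero 1)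
    rw [twisted_apply] at this
    simpa using this
  have h₂ : E' - E ∈ fil p (k + 1) := by
    simpa using add_mem (fil_mono (by omega) h₁) hbb
  have h₃ := expTw_sub_mem (p 0 + p 1 + 1 - δ) hb hb' hbb hc
  have h₄ := Submodule.smul_mem _ (δ : ℂ)⁻¹ (hamDer_mem_fil hh h₁)
  have h₅ := mul_mem_fil (add_mem h₂ (radialDer_mem_ws h₂)) (comb_mem_fil hs hh ha hd')
  have h₆ : E - 1 + radialDer p (E - 1) ∈ fil p 1 :=
    add_mem (expTw_one_sub_one_mem hb) (radialDer_mem_ws (expTw_one_sub_one_mem hb))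
  have h₇ := mul_mem_fil h₆ (comb_mem_fil hs hh ha hdd)
  have h₈ := sub_mem (sub_mem (add_mem (fil_mono (d := δ - p 0 - p 1 + (k + 2)) (by omega) h₄)
    (fil_mono (by omega) h₃)) (fil_mono (by omega) h₅)) (fil_mono (by omega) h₇)
  convert h₈ using 1
  simp only [residue, comb_sub hs, map_sub, smul_sub, Derivation.map_one_eq_zero]
  ring

theorem residue_sub_mem (hh : h ∈ hom p δ) (hs : PowerSeries.HasSubst h)
    (ha : ∀ i, a i ∈ hom p (e i)) (hc : c ∈ fil p (level p δ 1)) {k : ℕ}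
    (hb : b ∈ fil p 1) (hb' : b' ∈ fil p 1) (hbb : b' - b ∈ fil p (k + 1))
    (hd' : d' ∈ combFil δ e (level p δ 1))
    (hdd : d' - d ∈ combFil δ e (level p δ (k + 1))) :
    residue p δ h c a b' d' - residue p δ h c a b d ∈ fil p (level p δ (k + 1)) := by
  have h₁ := residue_sub_sub_mem hh hs ha hc hb hb' hbb hd' hdd
  have h₂ := Submodule.smul_mem _ (δ : ℂ)⁻¹ (hamDer_mem_fil hh hbb)
  have h₃ := comb_mem_fil hs hh ha hdd
  unfold level at *
  have := add_mem (fil_mono (d := δ - p 0 - p 1 + (k + 1)) (by omega) h₁)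
    (sub_mem (fil_mono (by omega) h₂) h₃)
  simpa using this

theorem exists_residue_succ (hp : Nat.Coprime (p 0) (p 1)) (hδ : 0 < δ) (hh : h ∈ hom p δ)
    (hs : PowerSeries.HasSubst h) (ha : ∀ i, a i ∈ hom p (e i))
    (hspan : ∀ f : Formal, ∃ c : Fin μ → ℂ, f - ∑ i, c i • a i ∈ jacobianIdeal h)
    (hc : c ∈ fil p (level p δ 1)) {k : ℕ} (hb : b ∈ fil p 1)
    (hd : d ∈ combFil δ e (level p δ 1))
    (hr : residue p δ h c a b d ∈ fil p (level p δ (k + 1))) :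
    ∃ b' d', b' ∈ fil p 1 ∧ d' ∈ combFil δ e (level p δ 1) ∧
      residue p δ h c a b' d' ∈ fil p (level p δ (k + 2)) ∧
      b' - b ∈ fil p (k + 1) ∧ d' - d ∈ combFil δ e (level p δ (k + 1)) := by
  set r := homComp p (level p δ (k + 1)) (residue p δ h c a b d) with hr_def
  obtain ⟨g, hg, d₀, hd₀, hgd⟩ := exists_homogeneous_decomposition hp hδ hh hs ha hspan
    ((level p δ (k + 1)).toNat + 1) (level p δ (k + 1)) (by omega) r (homComp_mem_hom _ _)
  -- Adding -δ g to b and d₀ to d changes the residue by -(H(g) + ∑ d₀ᵢ(h) aᵢ) = -r to leading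
  -- order; `level` is normalized so that g has weight k + 1.
  have hg' : -((δ : ℂ) • g) ∈ fil p (k + 1) := by
    refine neg_mem (Submodule.smul_mem _ _ (fil_mono ?_ (hom_le_fil _ hg)))
    unfold level
    omega
  have hd₀' : d₀ ∈ combFil δ e (level p δ (k + 1)) := fun i j hj => (hd₀ i j hj).ge
  have hb' : b + -((δ : ℂ) • g) ∈ fil p 1 := add_mem hb (fil_mono (by omega) hg')
  have hd' : d + d₀ ∈ combFil δ e (level p δ 1) :=
    add_mem hd (combFil_mono (by unfold level; omega) hd₀')
  have h₁ : b + -((δ : ℂ) • g) - b ∈ fil p (k + 1) := by rwa [add_sub_cancel_left]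
  have h₂ : d + d₀ - d ∈ combFil δ e (level p δ (k + 1)) := by rwa [add_sub_cancel_left]
  refine ⟨_, _, hb', hd', ?_, h₁, h₂⟩
  have h₃ := residue_sub_sub_mem hh hs ha hc hb hb' h₁ hd' h₂
  have h₄ := sub_homComp_mem_fil hr
  rw [← hr_def, hgd, show level p δ (k + 1) + 1 = level p δ (k + 2) by unfold level; ring] at h₄
  convert add_mem h₃ h₄ using 1
  have hδ' : (δ : ℂ) ≠ 0 := by exact_mod_cast hδ.ne'
  rw [add_sub_cancel_left, add_sub_cancel_left, map_neg, Derivation.map_smul, smul_neg, smul_smul,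
    inv_mul_cancel₀ hδ', one_smul]
  ring

theorem exists_seq_of_step {α : Type*} {P : ℕ → α → Prop} {Q : ℕ → α → α → Prop}
    (h₀ : ∃ x, P 0 x) (hstep : ∀ k x, P k x → ∃ y, P (k + 1) y ∧ Q k x y) :
    ∃ s : ℕ → α, ∀ k, P k (s k) ∧ Q k (s k) (s (k + 1)) := by
  obtain ⟨x₀, hx₀⟩ := h₀
  choose F hF hQ using hstep
  let s : ∀ k, {x // P k x} := fun k =>
    Nat.rec ⟨x₀, hx₀⟩ (fun k x => ⟨F k x.1 x.2, hF k x.1 x.2⟩) k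
  exact ⟨fun k => (s k).1, fun k => ⟨(s k).2, hQ k (s k).1 (s k).2⟩⟩

/-- Each entry is frozen once k reaches its weight, so the limit is read off there; negative weights
are frozen from k = 0. -/
theorem exists_limit {ι : Type*} (w : ι → ℤ) (u : ℕ → ι → ℂ)
    (hu : ∀ (k : ℕ) i, w i < k + 1 → u (k + 1) i = u k i) :
    ∃ v : ι → ℂ, ∀ (k : ℕ) i, w i < k + 1 → v i = u k i := by
  refine ⟨fun i => u (w i).toNat i, fun k i hk => ?_⟩
  obtain ⟨l, rfl⟩ := Nat.exists_eq_add_of_le (show (w i).toNat ≤ k by omega)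
  clear hk
  induction l with
  | zero => rfl
  | succ l ih => rw [ih, ← add_assoc, hu _ _ (by push_cast; omega)]

theorem exists_residue_eq_zero (hp : Nat.Coprime (p 0) (p 1)) (hδ : 0 < δ) (hh : h ∈ hom p δ)
    (hs : PowerSeries.HasSubst h) (ha : ∀ i, a i ∈ hom p (e i))
    (hspan : ∀ f : Formal, ∃ c : Fin μ → ℂ, f - ∑ i, c i • a i ∈ jacobianIdeal h)
    (hc : c ∈ fil p (level p δ 1)) :
    ∃ b ∈ fil p 1, ∃ d, residue p δ h c a b d = 0 := by
  obtain ⟨s, hs'⟩ := exists_seq_of_step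
    (P := fun k x => x.1 ∈ fil p 1 ∧ x.2 ∈ combFil δ e (level p δ 1) ∧
      residue p δ h c a x.1 x.2 ∈ fil p (level p δ (k + 1)))
    (Q := fun k x y => y.1 - x.1 ∈ fil p (k + 1) ∧
      y.2 - x.2 ∈ combFil δ e (level p δ (k + 1)))
    -- At b = 0, d = 0 one has U = 1 and the residue is c.
    ⟨((0 : Formal), (0 : Fin μ → PowerSeries ℂ)), zero_mem _, zero_mem _, by
      have h₁ (z : ℂ) (f : Formal) : expTw p 0 z f = f :=
        expOp_eq_self (raises_twisted (zero_mem _) z) (by simp [twisted_apply])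
      have h₂ : comb h a (0 : Fin μ → PowerSeries ℂ) = 0 := by
        simpa using comb_sub hs a (0 : Fin μ → PowerSeries ℂ) 0
      simpa [residue, h₁, h₂] using hc⟩
    (fun k x hx => by
      obtain ⟨b', d', h₁, h₂, h₃, h₄, h₅⟩ :=
        exists_residue_succ hp hδ hh hs ha hspan hc hx.1 hx.2.1 hx.2.2
      refine ⟨(b', d'), ⟨h₁, h₂, ?_⟩, h₄, h₅⟩
      convert h₃ using 3
      push_cast
      ring)
  obtain ⟨b, hb⟩ : ∃ b : Formal, ∀ k : ℕ, b - (s k).1 ∈ fil p (k + 1) := by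
    obtain ⟨v, hv⟩ := exists_limit (wt p) (fun k n => coeff n (s k).1) fun k n hn => by
      rw [← sub_eq_zero, ← map_sub]
      exact coeff_eq_zero_of_mem_ws (hs' k).2.1 (by simpa using hn)
    refine ⟨v, fun k n hn => ?_⟩
    by_contra hlt
    exact hn (sub_eq_zero.2 (hv k n (by simpa using hlt)))
  obtain ⟨d, hd⟩ : ∃ d, ∀ k : ℕ, d - (s k).2 ∈ combFil δ e (level p δ (k + 1)) := by
    -- Subtracting `level p δ 0` turns the bound `level p δ (k + 1)` into k + 1.
    obtain ⟨v, hv⟩ := exists_limit (fun x : Fin μ × ℕ => (x.2 * δ + e x.1 - level p δ 0 : ℤ))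
      (fun k x => PowerSeries.coeff x.2 ((s k).2 x.1)) fun k x hx => by
        rw [← sub_eq_zero, ← map_sub]
        by_contra hne
        have := (hs' k).2.2 x.1 x.2 hne
        unfold level at *
        omega
    refine ⟨fun i => PowerSeries.mk fun j => v (i, j), fun k i j hj => ?_⟩
    by_contra hlt
    apply hj
    have := hv k (i, j) (by simp only; unfold level at *; omega)
    simp [this]
  have hb₁ : b ∈ fil p 1 := by
    have := add_mem (hb 0) (hs' 0).1.1
    simpa using this
  have hd₁ : d ∈ combFil δ e (level p δ 1) := by
    have := add_mem (hd 0) (hs' 0).1.2.1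
    simpa using this
  refine ⟨b, hb₁, d, eq_zero_of_forall_mem_fil (p := p) (level p δ 1) fun k => ?_⟩
  have h₁ := add_mem (residue_sub_mem hh hs ha hc (hs' k).1.1 hb₁ (hb k) hd₁ (hd k))
    (hs' k).1.2.2
  rw [sub_add_cancel] at h₁
  exact fil_mono (by unfold level; omega) h₁

/-! ### Logarithmic forms in the basis ω₀, ω_R, and their pullback by exp(bR). -/

theorem exists_saito_coordinates (hh : h ∈ hom p δ) (hδ : 0 < δ)
    [Module.Finite ℂ (Formal ⧸ jacobianIdeal h)] {η₀ η₁ : Formal}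
    (h₀ : η₀ ∈ fil p (δ - p 0 + 1)) (h₁ : η₁ ∈ fil p (δ - p 1 + 1))
    (hlog : h ∣ η₁ * pderiv ℂ 0 h - η₀ * pderiv ℂ 1 h) :
    ∃ F ∈ fil p 1, ∃ G ∈ fil p (level p δ 1),
      η₀ = F * ((δ : ℂ)⁻¹ • pderiv ℂ 0 h) - (p 1 : Formal) * X 1 * G ∧
      η₁ = F * ((δ : ℂ)⁻¹ • pderiv ℂ 1 h) + (p 0 : Formal) * X 0 * G := by
  have hne := ne_zero_of_finite (h := h)
  have hδ' : (C (δ : ℂ)⁻¹ : Formal) * (δ : Formal) = 1 := by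
    rw [← map_natCast (C : ℂ →+* Formal), ← map_mul, inv_mul_cancel₀, map_one]
    exact_mod_cast hδ.ne'
  have he := euler hh
  obtain ⟨K, hK⟩ := hlog
  -- By Euler's relation and the logarithmic condition, h divides the contraction of η with R after
  -- multiplication by h_x or h_y, hence before it.
  obtain ⟨F, hF⟩ : h ∣ (p 0 : Formal) * X 0 * η₀ + (p 1 : Formal) * X 1 * η₁ := by
    refine dvd_of_dvd_pderiv_mul fun i => ?_
    fin_cases i
    · exact ⟨(δ : Formal) * η₀ + (p 1 : Formal) * X 1 * K, by
        simp only [Fin.zero_eta]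
        linear_combination η₀ * he + (p 1 : Formal) * X 1 * hK⟩
    · exact ⟨(δ : Formal) * η₁ - (p 0 : Formal) * X 0 * K, by
        simp only [Fin.mk_one]
        linear_combination η₁ * he - (p 0 : Formal) * X 0 * hK⟩
  refine ⟨F, ?_, C (δ : ℂ)⁻¹ * K, ?_, ?_, ?_⟩
  · refine mem_fil_of_mul_mem_fil hh hne ?_
    rw [mul_comm, ← hF]
    have h₂ := mul_mem_fil (hom_le_fil _ (X_mem_hom 0)) h₀
    have h₃ := mul_mem_fil (hom_le_fil _ (X_mem_hom 1)) h₁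
    rw [mul_assoc, mul_assoc, ← nsmul_eq_mul, ← nsmul_eq_mul]
    exact add_mem (nsmul_mem (fil_mono (by omega) h₂) _) (nsmul_mem (fil_mono (by omega) h₃) _)
  · rw [← smul_eq_C_mul]
    refine Submodule.smul_mem _ _ (mem_fil_of_mul_mem_fil hh hne ?_)
    rw [mul_comm, ← hK]
    have h₂ := mul_mem_fil h₁ (hom_le_fil _ (pderiv_mem_hom 0 hh))
    have h₃ := mul_mem_fil h₀ (hom_le_fil _ (pderiv_mem_hom 1 hh))
    unfold level
    exact sub_mem (fil_mono (by omega) h₂) (fil_mono (by omega) h₃)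
  · rw [smul_eq_C_mul]
    apply mul_left_cancel₀ hne
    linear_combination -(η₀ * h) * hδ' - C (δ : ℂ)⁻¹ * η₀ * he +
      C (δ : ℂ)⁻¹ * pderiv ℂ 0 h * hF - C (δ : ℂ)⁻¹ * (p 1 : Formal) * X 1 * hK
  · rw [smul_eq_C_mul]
    apply mul_left_cancel₀ hne
    linear_combination -(η₁ * h) * hδ' - C (δ : ℂ)⁻¹ * η₁ * he +
      C (δ : ℂ)⁻¹ * pderiv ℂ 1 h * hF + C (δ : ℂ)⁻¹ * (p 0 : Formal) * X 0 * hK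

end

section

variable {p : Fin 2 → ℕ} {b c : Formal} {δ : ℕ}

theorem diffeo_C (Φ : FormalDiffeo) (z : ℂ) : Φ (C z : Formal) = C z := by
  have := Φ.commutes z
  rwa [MvPowerSeries.algebraMap_apply] at this

/-- The chain rule on polynomials needs no continuity of Φ, and it suffices because h is a
polynomial. -/
theorem pderiv_diffeo_coe (Φ : FormalDiffeo) (j : Fin 2) (P : MvPolynomial (Fin 2) ℂ) :
    pderiv ℂ j (Φ (P : Formal)) =
      ∑ i, Φ (pderiv ℂ i (P : Formal)) * pderiv ℂ j (Φ (X i)) := by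
  induction P using MvPolynomial.induction_on with
  | C z => simp [diffeo_C]
  | add P Q hP hQ =>
    simp only [MvPolynomial.coe_add, map_add, hP, hQ, add_mul, Finset.sum_add_distrib]
  | mul_X P k hP =>
    simp only [MvPolynomial.coe_mul, MvPolynomial.coe_X, map_mul, Derivation.leibniz, hP,
      smul_eq_mul, map_add, add_mul, Finset.sum_add_distrib, Finset.mul_sum]
    have h : ∑ i, Φ (P : Formal) * Φ (pderiv ℂ i (X k)) * pderiv ℂ j (Φ (X i)) =
        Φ (P : Formal) * pderiv ℂ j (Φ (X k)) := by
      simp [pderiv_X, Pi.single_apply]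
    rw [h]
    congr 1
    exact Finset.sum_congr rfl fun i _ => by ring

theorem mul_pderiv_pow (j : Fin 2) (U : Formal) (n : ℕ) :
    U * pderiv ℂ j (U ^ n) = (n : Formal) * U ^ n * pderiv ℂ j U := by
  induction n with
  | zero => simp
  | succ n ih =>
    rw [pow_succ, Derivation.leibniz, smul_eq_mul, smul_eq_mul]
    push_cast
    linear_combination U * ih

/-- The numerator of `h (ω₀ + c ω_R)`. -/
def numerator (p : Fin 2 → ℕ) (δ : ℕ) (h c : Formal) (i : Fin 2) : Formal :=
  (δ : ℂ)⁻¹ • pderiv ℂ i h + c * ![-(radial p 1), radial p 0] i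

/-- Since x and y become x U^p₀ and y U^p₁, the dU terms in the pullback of p₀ x dy - p₁ y dx
cancel. The extra factor U avoids exponents such as p₀ - 1. -/
theorem sum_diffeo_numerator (hb : b ∈ fil p 1) (h : MvPolynomial (Fin 2) ℂ)
    (hh : (h : Formal) ∈ hom p δ) (j : Fin 2) :
    expTw p b 1 1 * ∑ i, expEquiv p b hb (numerator p δ h c i) *
        pderiv ℂ j (expEquiv p b hb (X i)) =
      (δ : ℂ)⁻¹ • (expTw p b 1 1 * pderiv ℂ j ((h : Formal) * expTw p b 1 1 ^ δ)) +
        expTw p b 0 c * expTw p b 1 1 ^ (p 0 + p 1 + 1) * ![-(radial p 1), radial p 0] j := by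
  set Φ := expEquiv p b hb
  set U := expTw p b 1 1
  have hΦh : Φ (h : Formal) = h * U ^ δ := expTw_of_mem_hom hb hh
  have hX (i : Fin 2) : Φ (X i) = X i * U ^ p i := expTw_of_mem_hom hb (X_mem_hom i)
  have hc : expTw p b 0 c = Φ c := rfl
  have h₁ := pderiv_diffeo_coe Φ j h
  rw [hΦh] at h₁
  rw [h₁, hc]
  simp only [numerator, Fin.sum_univ_two, map_add, map_mul, diffeo_C, radial, map_natCast, map_neg,
    Matrix.cons_val_zero, Matrix.cons_val_one, smul_eq_C_mul, hX, Derivation.leibniz, smul_eq_mul]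
  have e₀ := mul_pderiv_pow j U (p 0)
  have e₁ := mul_pderiv_pow j U (p 1)
  have e₂ : ![-((p 1 : Formal) * X 1), (p 0 : Formal) * X 0] j =
      (p 0 : Formal) * X 0 * pderiv ℂ j (X 1) - (p 1 : Formal) * X 1 * pderiv ℂ j (X 0) := by
    fin_cases j <;> simp
  rw [e₂, pow_succ, pow_add]
  linear_combination Φ c * (p 0 : Formal) * X 0 * U ^ p 0 * X 1 * e₁ -
    Φ c * (p 1 : Formal) * X 1 * U ^ p 1 * X 0 * e₀

theorem numerator_pullback {μ : ℕ} {a : Fin μ → Formal} {d : Fin μ → PowerSeries ℂ} (hδ : 0 < δ)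
    (hb : b ∈ fil p 1) (h : MvPolynomial (Fin 2) ℂ) (hh : (h : Formal) ∈ hom p δ)
    (hres : residue p δ h c a b d = 0) (j : Fin 2) :
    expTw p b 1 1 * ∑ i, expEquiv p b hb (numerator p δ h c i) *
        pderiv ℂ j (expEquiv p b hb (X i)) =
      expTw p b 1 1 ^ δ * (expTw p b 1 1 + radialDer p (expTw p b 1 1)) *
        numerator p δ h (comb h a d) j := by
  rw [sum_diffeo_numerator hb h hh]
  unfold residue at hres
  set U := expTw p b 1 1
  have hδ' : (C (δ : ℂ)⁻¹ : Formal) * (δ : Formal) = 1 := by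
    rw [← map_natCast (C : ℂ →+* Formal), ← map_mul, inv_mul_cancel₀, map_one]
    exact_mod_cast hδ.ne'
  -- The exponent p₀ + p₁ + 1 - δ may be negative; multiplying by U^δ returns to natural powers.
  have hz : expTw p b (p 0 + p 1 + 1 - δ) c * U ^ δ =
      expTw p b 0 c * U ^ (p 0 + p 1 + 1) := by
    rw [expTw_eq_mul hb _ c, mul_assoc, ← expTw_natCast hb, ← expTw_natCast hb,
      ← expTw_add_one hb]
    congr 3
    push_cast
    ring
  have he := euler hh
  have hpow := mul_pderiv_pow j U δ
  -- This is dU = R(U) ω₀ + δ⁻¹ H(U) ω_R, multiplied by h.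
  have hrad : (h : Formal) * pderiv ℂ j U = radialDer p U * (C (δ : ℂ)⁻¹ * pderiv ℂ j h) +
      C (δ : ℂ)⁻¹ * hamDer h U * ![-(radial p 1), radial p 0] j := by
    rw [radialDer_apply, hamDer_apply]
    fin_cases j
    · simp [radial]
      linear_combination -((h : Formal) * pderiv ℂ 0 U) * hδ' - C (δ : ℂ)⁻¹ * pderiv ℂ 0 U * he
    · simp [radial]
      linear_combination -((h : Formal) * pderiv ℂ 1 U) * hδ' - C (δ : ℂ)⁻¹ * pderiv ℂ 1 U * he
  rw [← hz, numerator]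
  simp only [smul_eq_C_mul, Derivation.leibniz, smul_eq_mul] at hres ⊢
  set r := ![-(radial p 1), radial p 0] j
  linear_combination C (δ : ℂ)⁻¹ * (h : Formal) * hpow + (h : Formal) * U ^ δ * pderiv ℂ j U * hδ' +
    U ^ δ * hrad + U ^ δ * r * hres

theorem pullback_div (Φ : FormalDiffeo) {h : Formal} {ω : MeroForm} {N : Fin 2 → Formal}
    (hω : ∀ i, ω i = algebraMap Formal Mero (N i) / algebraMap Formal Mero h) (j : Fin 2) :
    Φ.pullback ω j = algebraMap Formal Mero (∑ i, Φ (N i) * pderiv ℂ j (Φ (X i))) /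
      algebraMap Formal Mero (Φ h) := by
  have hmap (f : Formal) : IsFractionRing.ringEquivOfRingEquiv (K := Mero) (L := Mero)
      Φ.toRingEquiv (algebraMap Formal Mero f) = algebraMap Formal Mero (Φ f) := by
    simp
  simp only [FormalDiffeo.pullback, hω, map_div₀, hmap, map_sum, map_mul, Finset.sum_div]
  exact Finset.sum_congr rfl fun i _ => by ring

theorem normalForm_eq {μ : ℕ} (h : Formal) (a : Fin μ → Formal) (d : Fin μ → PowerSeries ℂ)
    (j : Fin 2) : normalForm p h δ a d j =
      algebraMap Formal Mero (numerator p δ h (comb h a d) j) / algebraMap Formal Mero h := by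
  have hC : algebraMap Formal Mero (C (δ : ℂ)⁻¹) = (δ : Mero)⁻¹ := by
    have : (C (δ : ℂ)⁻¹ : Formal) = algebraMap ℂ Formal (δ : ℂ)⁻¹ := rfl
    rw [this, ← IsScalarTower.algebraMap_apply ℂ Formal Mero, map_inv₀, map_natCast]
  have hR : omegaR p h j = algebraMap Formal Mero (![-(radial p 1), radial p 0] j) /
      algebraMap Formal Mero h := by
    fin_cases j
    · simp [omegaR, sharp]
      ring
    · simp [omegaR, sharp]
  simp only [normalForm, omega0, hR, numerator, comb, smul_eq_C_mul, map_add, map_mul, hC, map_sum]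
  rw [← Finset.sum_mul]
  ring

/-- For ω = N/h one has h dω = dN - (dh ∧ N)/h, so holomorphy means that h divides dh ∧ N. -/
theorem dvd_of_isLogForm {h : Formal} (hne : h ≠ 0) {ω : MeroForm} {N : Fin 2 → Formal}
    (hω : ∀ i, ω i = algebraMap Formal Mero (N i) / algebraMap Formal Mero h)
    (hlog : IsLogForm h ω) : h ∣ N 1 * pderiv ℂ 0 h - N 0 * pderiv ℂ 1 h := by
  obtain ⟨K, hK⟩ := hlog.2
  have inj := IsFractionRing.injective Formal Mero
  have hne' : algebraMap Formal Mero h ≠ 0 := fun h0 => hne (inj (by rw [h0, map_zero]))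
  rw [hω, hω, meroPderiv_div _ _ _ hne, meroPderiv_div _ _ _ hne, ← sub_div, mul_div_assoc',
    div_eq_iff (pow_ne_zero 2 hne'), ← map_sub, ← map_mul, ← map_pow, ← map_mul] at hK
  have hK' := inj hK
  refine ⟨pderiv ℂ 0 (N 1) - pderiv ℂ 1 (N 0) - K, mul_left_cancel₀ hne ?_⟩
  linear_combination -hK'

/-- A logarithmic perturbation of `ω₀` is a unit times `ω₀ + c ω_R`. -/
theorem exists_eq_unit_mul {h : Formal} (hh : h ∈ hom p δ) (hδ : 0 < δ)
    [Module.Finite ℂ (Formal ⧸ jacobianIdeal h)] {ω : MeroForm}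
    (hω : IsPerturbation p h δ ω) :
    ∃ v : Formal, IsUnit v ∧ ∃ c ∈ fil p (level p δ 1), ∀ i,
      ω i = algebraMap Formal Mero (v * numerator p δ h c i) / algebraMap Formal Mero h := by
  have hne := ne_zero_of_finite (h := h)
  have hne' : algebraMap Formal Mero h ≠ 0 := fun h0 =>
    hne (IsFractionRing.injective Formal Mero (by rw [h0, map_zero]))
  obtain ⟨hlog, η, hη, hηw⟩ := hω
  have hC : algebraMap Formal Mero (C (δ : ℂ)⁻¹) = (δ : Mero)⁻¹ := by
    have : (C (δ : ℂ)⁻¹ : Formal) = algebraMap ℂ Formal (δ : ℂ)⁻¹ := rfl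
    rw [this, ← IsScalarTower.algebraMap_apply ℂ Formal Mero, map_inv₀, map_natCast]
  have hN (i : Fin 2) : ω i = algebraMap Formal Mero (C (δ : ℂ)⁻¹ * pderiv ℂ i h + η i) /
      algebraMap Formal Mero h := by
    rw [map_add, map_mul, hC, ← hη i, omega0]
    field_simp
    ring
  have hw (i : Fin 2) : η i ∈ fil p (δ - p i + 1) := fun n hn => by
    have := hηw i n hn
    simp only [wt, Set.mem_Ici]
    omega
  obtain ⟨F, hF, G, hG, h₀, h₁⟩ := exists_saito_coordinates hh hδ (hw 0) (hw 1) (by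
    have := dvd_of_isLogForm hne hN hlog
    convert this using 1
    ring)
  have hu : IsUnit (1 + F) := by
    rw [isUnit_iff_constantCoeff, map_add, constantCoeff_eq_zero_of_mem_fil_one hF]
    simp
  obtain ⟨w, hw'⟩ := hu.exists_right_inv
  -- ω = (1 + F) ω₀ + G ω_R, so c = G / (1 + F).
  refine ⟨1 + F, hu, w * G, by simpa using mul_mem_fil (mem_fil_zero w) hG, fun i => ?_⟩
  rw [hN i, numerator, smul_eq_C_mul]
  rw [smul_eq_C_mul] at h₀ h₁
  congr 2
  fin_cases i
  · simp [radial]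
    linear_combination h₀ + ((p 1 : Formal) * X 1 * G) * hw'
  · simp [radial]
    linear_combination h₁ - ((p 0 : Formal) * X 0 * G) * hw'

theorem constantCoeff_expTw_one (hb : b ∈ fil p 1) : constantCoeff (expTw p b 1 1) = 1 := by
  have := constantCoeff_eq_zero_of_mem_fil_one (expTw_one_sub_one_mem hb)
  rwa [map_sub, sub_eq_zero, map_one constantCoeff] at this

theorem isUnit_expTw_one (hb : b ∈ fil p 1) : IsUnit (expTw p b 1 1) := by
  rw [isUnit_iff_constantCoeff, constantCoeff_expTw_one hb]
  exact isUnit_one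

theorem isUnit_expTw_one_add_radialDer (hb : b ∈ fil p 1) :
    IsUnit (expTw p b 1 1 + radialDer p (expTw p b 1 1)) := by
  have h := constantCoeff_eq_zero_of_mem_fil_one (radialDer_mem_ws (expTw_one_sub_one_mem hb))
  rw [map_sub, Derivation.map_one_eq_zero, sub_zero] at h
  rw [isUnit_iff_constantCoeff, map_add, constantCoeff_expTw_one hb, h, add_zero]
  exact isUnit_one

end

end LogFoliation

end

open LogFoliation in
theorem mainTheorem7 (p : Fin 2 → ℕ) (hp : Nat.Coprime (p 0) (p 1))
    (δ : ℕ) (h : MvPolynomial (Fin 2) ℂ)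
    (hh : MvPolynomial.IsWeightedHomogeneous p h δ)
    (hsing : LogFoliation.HasIsolatedSingularity (h : MvPowerSeries (Fin 2) ℂ))
    (μ : ℕ) (a : Fin μ → MvPolynomial (Fin 2) ℂ)
    (ha : ∀ i, ∃ e : ℕ, MvPolynomial.IsWeightedHomogeneous p (a i) e)
    (B : Module.Basis (Fin μ) ℂ
      (MvPowerSeries (Fin 2) ℂ ⧸ LogFoliation.jacobianIdeal (h : MvPowerSeries (Fin 2) ℂ)))
    (hB : ∀ i, B i = Ideal.Quotient.mk _ (a i : MvPowerSeries (Fin 2) ℂ))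
    (ω : LogFoliation.MeroForm)
    (hω : LogFoliation.IsPerturbation p (h : MvPowerSeries (Fin 2) ℂ) δ ω) :
    ∃ (d : Fin μ → PowerSeries ℂ) (Φ : LogFoliation.FormalDiffeo)
      (u : MvPowerSeries (Fin 2) ℂ),
      Φ.IsFibred p ∧ IsUnit u ∧
      ∀ j, Φ.pullback ω j =
        algebraMap (MvPowerSeries (Fin 2) ℂ) LogFoliation.Mero u *
          LogFoliation.normalForm p (h : MvPowerSeries (Fin 2) ℂ) δ
            (fun i => (a i : MvPowerSeries (Fin 2) ℂ)) d j := by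
  have := hsing.2
  have hhom : (h : Formal) ∈ hom p δ := coe_mem_hom hh
  have hδ := weight_pos_of_hasIsolatedSingularity hp hhom hsing
  have hne := ne_zero_of_finite (h := (h : Formal))
  have hs : PowerSeries.HasSubst (h : Formal) := PowerSeries.HasSubst.of_constantCoeff_zero
    (constantCoeff_eq_zero_of_mem_fil_one (p := p) (fil_mono (by omega) (hom_le_fil _ hhom)))
  choose e he using ha
  have ha' (i : Fin μ) : (a i : Formal) ∈ hom p (e i) := coe_mem_hom (he i)
  have hspan (f : Formal) :
      ∃ c : Fin μ → ℂ, f - ∑ i, c i • (a i : Formal) ∈ jacobianIdeal (h : Formal) := by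
    refine ⟨B.repr (Ideal.Quotient.mk _ f), ?_⟩
    rw [← Ideal.Quotient.eq, ← Ideal.Quotient.mkₐ_eq_mk ℂ, map_sum]
    conv_lhs => rw [← B.sum_repr (Ideal.Quotient.mkₐ ℂ _ f)]
    refine Finset.sum_congr rfl fun i _ => ?_
    rw [map_smul, hB]
    rfl
  obtain ⟨v, hv, c, hc, hωc⟩ := exists_eq_unit_mul hhom hδ hω
  obtain ⟨b, hb, d, hres⟩ := exists_residue_eq_zero hp hδ hhom hs ha' hspan hc
  obtain ⟨w, hw⟩ := (isUnit_expTw_one hb).exists_right_inv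
  -- The unit is Φ(v) U⁻¹ (U + R(U)); the factor U^δ of `numerator_pullback` cancels against Φ(h) =
  -- h U^δ.
  refine ⟨d, expEquiv p b hb,
    expEquiv p b hb v * (w * (expTw p b 1 1 + radialDer p (expTw p b 1 1))),
    isFibred_expEquiv hb, (hv.map _).mul ((IsUnit.of_mul_eq_one _ (by rw [mul_comm, hw])).mul
      (isUnit_expTw_one_add_radialDer hb)),
    fun j => ?_⟩
  have inj := IsFractionRing.injective Formal Mero
  have hΦh : expEquiv p b hb (h : Formal) = h * expTw p b 1 1 ^ δ := expTw_of_mem_hom hb hhom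
  have hΦh0 : expEquiv p b hb (h : Formal) ≠ 0 := by simpa using hne
  have key := numerator_pullback hδ hb h hhom hres j
  rw [pullback_div _ hωc, normalForm_eq, mul_div_assoc', div_eq_div_iff
    ((map_ne_zero_iff _ inj).2 hΦh0) ((map_ne_zero_iff _ inj).2 hne), ← map_mul, ← map_mul,
    ← map_mul]
  congr 1
  simp only [map_mul, mul_assoc, ← Finset.mul_sum]
  rw [hΦh]
  set S := ∑ i, expEquiv p b hb (numerator p δ (h : Formal) c i) *
    MvPowerSeries.pderiv ℂ j (expEquiv p b hb (MvPowerSeries.X i))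
  linear_combination (expEquiv p b hb v * h * w) * key - (expEquiv p b hb v * h * S) * hw
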